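/- Let $(M,g,\nabla,\nabla^*)$ be a dually flat manifold: $M$ is a smooth (Hausdorff, boundaryless) $n$-dimensional manifold, $g$ a smooth Riemannian metric on $M$, and $\nabla,\nabla^*$ smooth affine connections that are dual with respect to $g$, i.e. $X\,g(Y,Z)=g(\nabla_XY,Z)+g(Y,\nabla^*_XZ)$ for all vector fields $X,Y,Z$, and that are both torsion-free and flat (of zero curvature). Then $M$ carries a pair of Monge–Ampère manifold structures, one in $\nabla$-affine coordinates $\eta$ and one in dual $\nabla^*$-affine coordinates $\eta^*$. Precisely: every point of $M$ has an open neighbourhood $U$ with smooth coordinate systems $\eta=(\eta^i)$ and $\eta^*=(\eta^*_i)$ on $U$, with coordinate fields $\partial_i=\partial/\partial\eta^i$ and $\partial^i=\partial/\partial\eta^*_i$, and smooth functions $\psi$ on $\eta(U)$ and $\psi^*$ on $\eta^*(U)$ such that 1. $\eta$ is $\nabla$-affine ($\nabla_{\partial_i}\partial_j=0$), $\eta^*$ is $\nabla^*$-affine ($\nabla^*_{\partial^i}\partial^j=0$), and they are mutually dual: $g(\partial_i,\partial^j)=\delta_i^j$; 2. $g(\partial_i,\partial_j)=g_{ij}=\partial_i\partial_j\psi(\eta)$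 and $g(\partial^i,\partial^j)=g^{ij}=\partial^i\partial^j\psi^*(\eta^*)$, where $(g^{ij})$ is the inverse matrix of $(g_{ij})$; 3. the coordinates are exchanged by the Legendre transformation: $\eta^*_i=\partial_i\psi(\eta)$, $\eta^i=\partial^i\psi^*(\eta^*)$ and $\psi(\eta)+\psi^*(\eta^*)=\sum_i\eta^i\eta^*_i$; 4. $\psi$ and $\psi^*$ solve elliptic Monge–Ampère equations: $\det\mathrm{Hess}(\psi)=f$ on $\eta(U)$ and $\det\mathrm{Hess}(\psi^*)=f^*$ on $\eta^*(U)$, with $f,f^*$ smooth and positive (in particular nowhere zero), and $\mathrm{Hess}(\psi)$, $\mathrm{Hess}(\psi^*)$ positive definite. -/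

import Mathlib

open scoped Manifold ContDiff Bundle

noncomputable section

/-! ### Dually flat manifolds -/

section DuallyFlat

variable {n : ℕ} {M : Type*} [TopologicalSpace M] [ChartedSpace (EuclideanSpace ℝ (Fin n)) M]
  [IsManifold (𝓡 n) ∞ M]

/-- An affine connection on `M`: a covariant derivative on the tangent bundle.
Argument order: `D Y x (X x)` is `(∇_X Y)(x)`. -/
abbrev AffineConnection (n : ℕ) (M : Type*) [TopologicalSpace M]
    [ChartedSpace (EuclideanSpace ℝ (Fin n)) M] [IsManifold (𝓡 n) ∞ M] :=
  CovariantDerivative (𝓡 n) (EuclideanSpace ℝ (Fin n)) (TangentSpace (𝓡 n) : M → Type _)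

/-- A smooth Riemannian metric on `M`. -/
abbrev SmoothMetric (n : ℕ) (M : Type*) [TopologicalSpace M]
    [ChartedSpace (EuclideanSpace ℝ (Fin n)) M] [IsManifold (𝓡 n) ∞ M] :=
  Bundle.ContMDiffRiemannianMetric (𝓡 n) ∞ (EuclideanSpace ℝ (Fin n))
    (TangentSpace (𝓡 n) : M → Type _)

/-- The vector field `X` is of class `C^∞` at `x`. -/
def SmoothFieldAt (X : Π x : M, TangentSpace (𝓡 n) x) (x : M) : Prop :=
  ContMDiffAt (𝓡 n) (𝓡 n).tangent ∞ (fun y ↦ (⟨y, X y⟩ : TangentBundle (𝓡 n) M)) x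

/-- The vector field `X` is differentiable at `x`. -/
def DiffFieldAt (X : Π x : M, TangentSpace (𝓡 n) x) (x : M) : Prop :=
  MDifferentiableAt (𝓡 n) (𝓡 n).tangent (fun y ↦ (⟨y, X y⟩ : TangentBundle (𝓡 n) M)) x

/-- The vector field `R(X, Y) Z = ∇_X ∇_Y Z - ∇_Y ∇_X Z - ∇_{[X, Y]} Z`. -/
def curvature (D : AffineConnection n M) (X Y Z : Π x : M, TangentSpace (𝓡 n) x) (x : M) :
    TangentSpace (𝓡 n) x :=
  D (fun y ↦ D Z y (Y y)) x (X x) - D (fun y ↦ D Z y (X y)) x (Y x)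
    - D Z x (VectorField.mlieBracket (𝓡 n) X Y x)

/-- The curvature of the connection vanishes at every point. -/
def IsFlatConnection (D : AffineConnection n M) : Prop :=
  ∀ (x : M) (X Y Z : Π x : M, TangentSpace (𝓡 n) x),
    SmoothFieldAt X x → SmoothFieldAt Y x → SmoothFieldAt Z x →
      curvature D X Y Z x = 0

/-- The two connections are dual with respect to the metric:
`X g(Y, Z) = g(∇_X Y, Z) + g(Y, ∇*_X Z)`. -/
def AreDualConnections (g : SmoothMetric n M) (D D' : AffineConnection n M) : Prop :=
  ∀ (x : M) (v : TangentSpace (𝓡 n) x) (Y Z : Π x : M, TangentSpace (𝓡 n) x),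
    DiffFieldAt Y x → DiffFieldAt Z x →
      mvfderiv (𝓡 n) (fun y ↦ g.inner y (Y y) (Z y)) x v
        = g.inner x (D Y x v) (Z x) + g.inner x (Y x) (D' Z x v)

/-- `(M, g, ∇, ∇*)` is a dually flat manifold: `∇` and `∇*` are smooth affine connections, dual
with respect to the Riemannian metric `g`, and both are torsion-free and flat. -/
structure IsDuallyFlat (g : SmoothMetric n M) (D D' : AffineConnection n M) : Prop where
  smooth : D.ContMDiffCovariantDerivative ∞
  smooth' : D'.ContMDiffCovariantDerivative ∞
  dual : AreDualConnections g D D'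
  torsion_free : D.torsion = 0
  torsion_free' : D'.torsion = 0
  flat : IsFlatConnection D
  flat' : IsFlatConnection D'

/-! ### Coordinate systems -/

/-- The `i`-th coordinate vector field `∂/∂ηⁱ` of the coordinate system `η`
(meaningful on the domain of `η`): `dη` sends it to the `i`-th standard basis vector. -/
def coordField (η : OpenPartialHomeomorph M (EuclideanSpace ℝ (Fin n))) (i : Fin n) :
    Π x : M, TangentSpace (𝓡 n) x :=
  VectorField.mpullback (𝓡 n) 𝓘(ℝ, EuclideanSpace ℝ (Fin n)) η
    (fun _ ↦ EuclideanSpace.single i (1 : ℝ))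

/-- The matrix `g(∂/∂ηⁱ, ∂/∂ηʲ)` of the metric at `x` in the coordinate system `η`. -/
def metricMatrix (g : SmoothMetric n M) (η : OpenPartialHomeomorph M (EuclideanSpace ℝ (Fin n)))
    (x : M) : Matrix (Fin n) (Fin n) ℝ :=
  Matrix.of fun i j ↦ g.inner x (coordField η i x) (coordField η j x)

/-- The coordinate system `η` is `∇`-affine: its coordinate fields are parallel,
`∇_{∂ᵢ} ∂ⱼ = 0` on the domain of `η`. -/
def IsAffineCoord (D : AffineConnection n M)
    (η : OpenPartialHomeomorph M (EuclideanSpace ℝ (Fin n))) : Prop :=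
  ∀ x ∈ η.source, ∀ i j : Fin n, D (coordField η j) x (coordField η i x) = 0

/-- Two coordinate systems are mutually dual: they have the same domain and their natural bases
are biorthogonal. -/
def AreDualCoord (g : SmoothMetric n M)
    (η η' : OpenPartialHomeomorph M (EuclideanSpace ℝ (Fin n))) : Prop :=
  η.source = η'.source ∧ ∀ x ∈ η.source, ∀ i j : Fin n,
    g.inner x (coordField η i x) (coordField η' j x) = if i = j then 1 else 0

end DuallyFlat

/-! ### Monge–Ampère manifolds -/

section MongeAmpere

variable {n : ℕ}

/-- The partial derivative `∂ᵢ Φ` of a function on `ℝⁿ`. -/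
def partialDeriv (i : Fin n) (Φ : EuclideanSpace ℝ (Fin n) → ℝ) :
    EuclideanSpace ℝ (Fin n) → ℝ :=
  fun y ↦ fderiv ℝ Φ y (EuclideanSpace.single i (1 : ℝ))

/-- The Hessian matrix `(∂ᵢ ∂ⱼ Φ)`. -/
def hessian (Φ : EuclideanSpace ℝ (Fin n) → ℝ) (y : EuclideanSpace ℝ (Fin n)) :
    Matrix (Fin n) (Fin n) ℝ :=
  Matrix.of fun i j ↦ partialDeriv i (partialDeriv j Φ) y

/-- `Φ` is a smooth solution on the open set `𝒟` of the elliptic Monge–Ampère equation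
`det Hess Φ = f` with smooth positive right-hand side `f`. -/
structure SolvesMongeAmpere (𝒟 : Set (EuclideanSpace ℝ (Fin n)))
    (Φ f : EuclideanSpace ℝ (Fin n) → ℝ) : Prop where
  isOpen_domain : IsOpen 𝒟
  smooth : ContDiffOn ℝ ∞ Φ 𝒟
  smooth_rhs : ContDiffOn ℝ ∞ f 𝒟
  rhs_pos : ∀ y ∈ 𝒟, 0 < f y
  elliptic : ∀ y ∈ 𝒟, (hessian Φ y).PosDef
  det_hessian : ∀ y ∈ 𝒟, (hessian Φ y).det = f y

/-- A Monge–Ampère manifold structure on `M`: around every point `p`, a smooth coordinate system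
and a smooth potential function which, in these coordinates, solves a Monge–Ampère equation. -/
structure MongeAmpereStructure (n : ℕ) (M : Type*) [TopologicalSpace M]
    [ChartedSpace (EuclideanSpace ℝ (Fin n)) M] [IsManifold (𝓡 n) ∞ M] where
  /-- the local coordinate system around `p` -/
  coord : M → OpenPartialHomeomorph M (EuclideanSpace ℝ (Fin n))
  /-- the local potential around `p`, as a function of the coordinates -/
  potential : M → EuclideanSpace ℝ (Fin n) → ℝ
  /-- the right-hand side of the local equation around `p`, as a function of the coordinates -/
  rhs : M → EuclideanSpace ℝ (Fin n) → ℝ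
  mem_source : ∀ p, p ∈ (coord p).source
  coord_mem_atlas : ∀ p, coord p ∈ IsManifold.maximalAtlas (𝓡 n) ∞ M
  solves : ∀ p, SolvesMongeAmpere (coord p).target (potential p) (rhs p)

end MongeAmpere

end

/-!
Around a point, flatness of `∇` makes the system for parallel coframes integrable, so parallel
transport along rays gives a parallel coframe; its differentiability in the end point follows from
the equation of variations, of which flatness exhibits an explicit solution. As `∇` is torsion-free,
this coframe is closed, hence the differential of `∇`-affine coordinates `η`.

In these coordinates, duality expresses the Christoffel symbols of `∇*` through the derivatives of
`g`, and torsion-freeness of `∇*` says that `∂ₖ gᵢⱼ` is totally symmetric. Applying Poincaré's lemma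
twice on a ball yields `ψ` with `Hess ψ = g`. The gradient of `ψ` has the positive definite
differential `g`, so it is locally a diffeomorphism and defines coordinates `η*` with
`g(∂ᵢ, ∂ʲ) = δᵢʲ`; since this pairing is constant and `η` is `∇`-affine, duality makes `η*`
`∇*`-affine. The inverse of the gradient map is the gradient of the Legendre transform `ψ*`.
-/

noncomputable section

open Set Metric Filter Topology

set_option maxSynthPendingDepth 3

section LinearODE

variable {E F : Type*} [NormedAddCommGroup E] [NormedSpace ℝ E]
  [NormedAddCommGroup F] [NormedSpace ℝ F]

theorem exists_linear_ode_solution [CompleteSpace F] {A : ℝ → F →L[ℝ] F} (e : F)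
    (hA : ContinuousOn A (Icc 0 1)) {K : ℝ} (hK : ∀ t ∈ Icc (0 : ℝ) 1, ‖A t‖ ≤ K)
    (hsmall : K * (‖e‖ + 1) ≤ 1) :
    ∃ α : ℝ → F, α 0 = e ∧
      ∀ t ∈ Icc (0 : ℝ) 1, HasDerivWithinAt α (A t (α t)) (Icc 0 1) t := by
  have hK0 : 0 ≤ K := (norm_nonneg _).trans (hK 0 (by simp))
  have hPL : IsPicardLindelof (fun t w ↦ A t w) (tmin := 0) (tmax := 1) ⟨0, by simp⟩ e 1 0 1
      ⟨K, hK0⟩ := by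
    refine ⟨fun t ht ↦ ?_, fun w _ ↦ hA.clm_apply continuousOn_const, fun t ht w hw ↦ ?_, ?_⟩
    · exact ((A t).lipschitz.weaken (show ‖A t‖₊ ≤ ⟨K, hK0⟩ from hK t ht)).lipschitzOnWith
    · have hw' : ‖w‖ ≤ ‖e‖ + 1 := norm_le_norm_add_const_of_dist_le (by simpa using hw)
      calc ‖A t w‖ ≤ K * (‖e‖ + 1) := (A t).le_of_opNorm_le_of_le (hK t ht) hw'
        _ ≤ 1 := hsmall
    · simp
  exact hPL.exists_eq_forall_mem_Icc_hasDerivWithinAt₀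

theorem norm_le_mul_exp_of_linear_ode {B : ℝ → F →L[ℝ] F} {R r : ℝ → F} {K ε : ℝ}
    (hR : ∀ t ∈ Icc (0 : ℝ) 1, HasDerivWithinAt R (B t (R t) + r t) (Icc 0 1) t) (hR0 : R 0 = 0)
    (hB : ∀ t ∈ Icc (0 : ℝ) 1, ‖B t‖ ≤ K) (hr : ∀ t ∈ Icc (0 : ℝ) 1, ‖r t‖ ≤ ε) :
    ‖R 1‖ ≤ ε * Real.exp K := by
  have hK : 0 ≤ K := (norm_nonneg _).trans (hB 0 (by simp))
  have hε : 0 ≤ ε := (norm_nonneg _).trans (hr 0 (by simp))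
  have hgronwall : ‖R 1‖ ≤ gronwallBound 0 K ε (1 - 0) :=
    norm_le_gronwallBound_of_norm_deriv_right_le
      (fun t ht ↦ (hR t ht).continuousWithinAt)
      (fun t ht ↦ (hR t (Ico_subset_Icc_self ht)).mono_of_mem_nhdsWithin
        (Icc_mem_nhdsGE_of_mem ht))
      (by simp [hR0])
      (fun t ht ↦ norm_add_le_of_le ((B t).le_of_opNorm_le (hB t (Ico_subset_Icc_self ht)) _)
        (hr t (Ico_subset_Icc_self ht)))
      1 (by simp)
  refine hgronwall.trans ?_
  rcases hK.eq_or_lt with rfl | hK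
  · simp [gronwallBound_K0]
  · have hexp : Real.exp K - 1 ≤ K * Real.exp K := by
      have := mul_le_mul_of_nonneg_right (Real.one_sub_le_exp_neg K) (Real.exp_pos K).le
      rw [← Real.exp_add, neg_add_cancel, Real.exp_zero] at this
      linarith
    calc gronwallBound 0 K ε (1 - 0) = ε * ((Real.exp K - 1) / K) := by
          rw [gronwallBound_of_K_ne_0 hK.ne']; simp; ring
      _ ≤ ε * Real.exp K := by
          gcongr
          rwa [div_le_iff₀' hK]

theorem eventually_forall_norm_sub_sub_fderiv_le {P : Type*} [NormedAddCommGroup P]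
    [NormedSpace ℝ P] {f : P × E → F} {S : Set P} (hS : IsCompact S) {x : E}
    (hf : ∀ t ∈ S, ContDiffAt ℝ 1 f (t, x)) {ε : ℝ} (hε : 0 < ε) :
    ∀ᶠ y in 𝓝 x, ∀ t ∈ S,
      ‖f (t, y) - f (t, x) - fderiv ℝ f (t, x) (0, y - x)‖ ≤ ε * ‖y - x‖ := by
  refine hS.eventually_forall_of_forall_eventually fun t ht ↦ ?_
  have hslice : Tendsto (fun z : E × P ↦ (z.2, x)) (𝓝 (x, t)) (𝓝 (t, x)) :=
    Continuous.tendsto' (by fun_prop) _ _ rfl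
  have hswap : Tendsto (fun z : E × P ↦ (z.2, z.1)) (𝓝 (x, t)) (𝓝 (t, x)) :=
    Continuous.tendsto' (by fun_prop) _ _ rfl
  have hstrict := ((hf t ht).hasStrictFDerivAt one_ne_zero).isLittleO.def (half_pos hε)
  have hderiv : ∀ᶠ p in 𝓝 (t, x), ‖fderiv ℝ f p - fderiv ℝ f (t, x)‖ < ε / 2 := by
    simpa only [dist_eq_norm] using
      ((hf t ht).continuousAt_fderiv one_ne_zero).eventually (ball_mem_nhds _ (half_pos hε))
  filter_upwards [(hswap.prodMk_nhds hslice).eventually hstrict, hslice.eventually hderiv]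
    with ⟨y, s⟩ hy hs
  have hdiff : ((s, y) : P × E) - (s, x) = (0, y - x) := by simp
  have hnorm : ‖((0, y - x) : P × E)‖ = ‖y - x‖ := by simp
  rw [hdiff, hnorm] at hy
  calc ‖f (s, y) - f (s, x) - fderiv ℝ f (s, x) (0, y - x)‖
      = ‖(f (s, y) - f (s, x) - fderiv ℝ f (t, x) (0, y - x)) -
          (fderiv ℝ f (s, x) - fderiv ℝ f (t, x)) (0, y - x)‖ := by
        rw [sub_apply]; congr 1; abel
    _ ≤ ε / 2 * ‖y - x‖ + ε / 2 * ‖y - x‖ :=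
        norm_sub_le_of_le hy
          (hnorm ▸ ContinuousLinearMap.le_of_opNorm_le _ hs.le ((0, y - x) : P × E))
    _ = ε * ‖y - x‖ := by ring

theorem hasDerivWithinAt_linear_ode_remainder {A : ℝ × E → F →L[ℝ] F} {A' : E →L[ℝ] F →L[ℝ] F}
    {α β : ℝ → F} {γ : ℝ → E →L[ℝ] F} {x y : E} {t : ℝ} {I : Set ℝ}
    (hα : HasDerivWithinAt α (A (t, x) (α t)) I t) (hβ : HasDerivWithinAt β (A (t, y) (β t)) I t)
    (hγ : HasDerivWithinAt γ (A (t, x) ∘L γ t + A'.flip (α t)) I t) :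
    HasDerivWithinAt (fun s ↦ β s - α s - γ s (y - x))
      (A (t, y) (β t - α t - γ t (y - x)) + ((A (t, y) - A (t, x)) (γ t (y - x)) +
        (A (t, y) - A (t, x) - A' (y - x)) (α t))) I t := by
  have hγy : HasDerivWithinAt (fun s ↦ γ s (y - x))
      (A (t, x) (γ t (y - x)) + A' (y - x) (α t)) I t := by
    simpa using hγ.clm_apply (hasDerivWithinAt_const t I (y - x))
  refine ((hβ.sub hα).sub hγy).congr_deriv ?_
  simp only [map_sub, sub_apply]
  abel

theorem norm_linear_ode_remainder_le {A : ℝ × E → F →L[ℝ] F} {A' : ℝ → E →L[ℝ] F →L[ℝ] F}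
    {α β : ℝ → F} {γ : ℝ → E →L[ℝ] F} {x y : E} {K L N Cα Cγ : ℝ}
    (hα : ∀ t ∈ Icc (0 : ℝ) 1, HasDerivWithinAt α (A (t, x) (α t)) (Icc 0 1) t)
    (hβ : ∀ t ∈ Icc (0 : ℝ) 1, HasDerivWithinAt β (A (t, y) (β t)) (Icc 0 1) t)
    (h0 : β 0 = α 0)
    (hγ : ∀ t ∈ Icc (0 : ℝ) 1,
      HasDerivWithinAt γ (A (t, x) ∘L γ t + (A' t).flip (α t)) (Icc 0 1) t)
    (hγ0 : γ 0 = 0) (hK : ∀ t ∈ Icc (0 : ℝ) 1, ‖A (t, y)‖ ≤ K)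
    (hL : ∀ t ∈ Icc (0 : ℝ) 1, ‖A (t, y) - A (t, x)‖ ≤ L)
    (hN : ∀ t ∈ Icc (0 : ℝ) 1, ‖A (t, y) - A (t, x) - A' t (y - x)‖ ≤ N)
    (hCα : ∀ t ∈ Icc (0 : ℝ) 1, ‖α t‖ ≤ Cα) (hCγ : ∀ t ∈ Icc (0 : ℝ) 1, ‖γ t‖ ≤ Cγ) :
    ‖β 1 - α 1 - γ 1 (y - x)‖ ≤ (L * (Cγ * ‖y - x‖) + N * Cα) * Real.exp K :=
  norm_le_mul_exp_of_linear_ode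
    (fun t ht ↦ hasDerivWithinAt_linear_ode_remainder (hα t ht) (hβ t ht) (hγ t ht))
    (by simp [h0, hγ0]) hK fun t ht ↦ norm_add_le_of_le
      (ContinuousLinearMap.le_of_opNorm_le_of_le _ (hL t ht) ((γ t).le_of_opNorm_le (hCγ t ht) _))
      (ContinuousLinearMap.le_of_opNorm_le_of_le _ (hN t ht) (hCα t ht))

theorem exists_eventually_forall_norm_sub_le {P : Type*} [NormedAddCommGroup P]
    [NormedSpace ℝ P] {f : P × E → F} {S : Set P} (hS : IsCompact S) {x : E}
    (hf : ∀ t ∈ S, ContDiffAt ℝ 1 f (t, x)) :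
    ∃ L, 0 ≤ L ∧ ∀ᶠ y in 𝓝 x, ∀ t ∈ S, ‖f (t, y) - f (t, x)‖ ≤ L * ‖y - x‖ := by
  have hcont : ContinuousOn (fun t ↦ fderiv ℝ f (t, x)) S := fun t ht ↦
    (ContinuousAt.comp (f := fun t : P ↦ (t, x)) ((hf t ht).continuousAt_fderiv one_ne_zero)
      (by fun_prop)).continuousWithinAt
  obtain ⟨C, hC⟩ := hS.exists_bound_of_continuousOn hcont
  refine ⟨1 + |C|, by positivity, ?_⟩
  filter_upwards [eventually_forall_norm_sub_sub_fderiv_le hS hf one_pos] with y hy t ht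
  calc ‖f (t, y) - f (t, x)‖
      = ‖(f (t, y) - f (t, x) - fderiv ℝ f (t, x) (0, y - x)) + fderiv ℝ f (t, x) (0, y - x)‖ := by
        rw [sub_add_cancel]
    _ ≤ 1 * ‖y - x‖ + |C| * ‖y - x‖ := norm_add_le_of_le (hy t ht) (by
        simpa using
          (fderiv ℝ f (t, x)).le_of_opNorm_le ((hC t ht).trans (le_abs_self C)) (0, y - x))
    _ = (1 + |C|) * ‖y - x‖ := by ring

theorem hasFDerivAt_linear_ode {A : ℝ × E → F →L[ℝ] F} {α : E → ℝ → F}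
    {γ : ℝ → E →L[ℝ] F} {x : E} (hA : ∀ t ∈ Icc (0 : ℝ) 1, ContDiffAt ℝ 1 A (t, x))
    (hα : ∀ᶠ y in 𝓝 x, ∀ t ∈ Icc (0 : ℝ) 1,
      HasDerivWithinAt (α y) (A (t, y) (α y t)) (Icc 0 1) t)
    (hα0 : ∀ᶠ y in 𝓝 x, α y 0 = α x 0)
    (hγ : ∀ t ∈ Icc (0 : ℝ) 1, HasDerivWithinAt γ
      (A (t, x) ∘L γ t + (fderiv ℝ A (t, x) ∘L .inr ℝ ℝ E).flip (α x t)) (Icc 0 1) t)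
    (hγ0 : γ 0 = 0) :
    HasFDerivAt (fun y ↦ α y 1) (γ 1) x := by
  have hαx := hα.self_of_nhds
  obtain ⟨L, hL0, hL⟩ := exists_eventually_forall_norm_sub_le isCompact_Icc hA
  have hAcont : ContinuousOn (fun t ↦ A (t, x)) (Icc 0 1) := fun t ht ↦
    (ContinuousAt.comp (f := fun t : ℝ ↦ (t, x)) (hA t ht).continuousAt
      (by fun_prop)).continuousWithinAt
  obtain ⟨K, hK⟩ := isCompact_Icc.exists_bound_of_continuousOn hAcont
  obtain ⟨Cα, hCα⟩ := isCompact_Icc.exists_bound_of_continuousOn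
    fun t ht ↦ (hαx t ht).continuousWithinAt
  obtain ⟨Cγ, hCγ⟩ := isCompact_Icc.exists_bound_of_continuousOn
    fun t ht ↦ (hγ t ht).continuousWithinAt
  have hCγ0 : 0 ≤ Cγ := (norm_nonneg _).trans (hCγ 0 (by simp))
  rw [hasFDerivAt_iff_isLittleO, Asymptotics.isLittleO_iff]
  intro ε hε
  obtain ⟨δ, hδ, hδε⟩ := exists_pos_mul_lt hε ((L * Cγ + Cα) * Real.exp (K + L))
  filter_upwards [hα, hα0, hL, eventually_forall_norm_sub_sub_fderiv_le isCompact_Icc hA hδ,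
    ball_mem_nhds x (lt_min one_pos hδ)] with y hαy hαy0 hLy hAy hy
  obtain ⟨hy1, hyδ⟩ := le_min_iff.1 (mem_ball_iff_norm.1 hy).le
  have hKy : ∀ t ∈ Icc (0 : ℝ) 1, ‖A (t, y)‖ ≤ K + L := fun t ht ↦ by
    rw [← add_sub_cancel (A (t, x)) (A (t, y))]
    exact norm_add_le_of_le (hK t ht) ((hLy t ht).trans (mul_le_of_le_one_right hL0 hy1))
  calc ‖α y 1 - α x 1 - γ 1 (y - x)‖
      ≤ (L * ‖y - x‖ * (Cγ * ‖y - x‖) + δ * ‖y - x‖ * Cα) * Real.exp (K + L) :=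
        norm_linear_ode_remainder_le hαx hαy hαy0 hγ hγ0 hKy hLy (by simpa using hAy) hCα hCγ
    _ ≤ (L * ‖y - x‖ * (Cγ * δ) + δ * ‖y - x‖ * Cα) * Real.exp (K + L) := by gcongr
    _ = (L * Cγ + Cα) * Real.exp (K + L) * δ * ‖y - x‖ := by ring
    _ ≤ ε * ‖y - x‖ := by gcongr

end LinearODE

section LinearFrobenius

variable {E F : Type*} [NormedAddCommGroup E] [NormedSpace ℝ E]
  [NormedAddCommGroup F] [NormedSpace ℝ F]

/-- The curvature of the connection form `Γ` vanishes at `y`: this is the integrability condition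
of the total differential equation `ds(v) = Γ(v) s`. -/
def IsFlatFormAt (Γ : E → E →L[ℝ] F →L[ℝ] F) (y : E) : Prop :=
  ∀ u v, fderiv ℝ Γ y u v + Γ y v ∘L Γ y u = fderiv ℝ Γ y v u + Γ y u ∘L Γ y v

theorem IsFlatFormAt.comp_add_const {Γ : E → E →L[ℝ] F →L[ℝ] F} {x₀ y : E}
    (h : IsFlatFormAt Γ (y + x₀)) : IsFlatFormAt (fun z ↦ Γ (z + x₀)) y := by
  simpa only [IsFlatFormAt, fderiv_comp_add_right] using h

theorem fderiv_ray_apply_inr {Γ : E → E →L[ℝ] F →L[ℝ] F} {t : ℝ} {x : E}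
    (hΓ : DifferentiableAt ℝ Γ (t • x)) (v : E) :
    fderiv ℝ (fun p : ℝ × E ↦ Γ (p.1 • p.2) p.2) (t, x) (0, v) =
      t • fderiv ℝ Γ (t • x) v x + Γ (t • x) v := by
  have hsnd : HasFDerivAt Prod.snd (.snd ℝ ℝ E) (t, x) := hasFDerivAt_snd
  have hsmul : HasFDerivAt (fun p : ℝ × E ↦ p.1 • p.2) _ (t, x) := hasFDerivAt_fst.smul hsnd
  have hray : HasFDerivAt (fun p : ℝ × E ↦ Γ (p.1 • p.2) p.2) _ (t, x) :=
    (HasFDerivAt.comp (t, x) (g := Γ) hΓ.hasFDerivAt hsmul).clm_apply hsnd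
  rw [hray.fderiv]
  simp [add_comm]

/-- By flatness, `t ↦ t Γ(tx) v α(t)` solves the equation of variations in the direction `v` of
the parallel transport equation along the ray through `x`. -/
theorem IsFlatFormAt.hasDerivWithinAt_smul_flip {Γ : E → E →L[ℝ] F →L[ℝ] F} {α : ℝ → F}
    {x : E} {t : ℝ} {I : Set ℝ} (hflat : IsFlatFormAt Γ (t • x))
    (hΓ : DifferentiableAt ℝ Γ (t • x)) (hα : HasDerivWithinAt α (Γ (t • x) x (α t)) I t) :
    HasDerivWithinAt (fun s ↦ s • (Γ (s • x)).flip (α s))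
      (Γ (t • x) x ∘L (t • (Γ (t • x)).flip (α t)) +
        (fderiv ℝ (fun p : ℝ × E ↦ Γ (p.1 • p.2) p.2) (t, x) ∘L .inr ℝ ℝ E).flip (α t)) I t := by
  have hray : HasDerivAt (fun s : ℝ ↦ s • x) x t := by simpa using (hasDerivAt_id t).smul_const x
  have hΓray := hΓ.hasFDerivAt.comp_hasDerivAt t hray
  have hflip : HasDerivAt (fun s : ℝ ↦ (Γ (s • x)).flip) (fderiv ℝ Γ (t • x) x).flip t :=
    (ContinuousLinearMap.flipₗᵢ ℝ E F F).hasFDerivAt.comp_hasDerivAt t hΓray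
  refine ((hasDerivWithinAt_id t I).smul (hflip.hasDerivWithinAt.clm_apply hα)).congr_deriv ?_
  ext v
  have hcurv := congr($(hflat x v) (α t))
  simp only [id_eq, one_smul, ContinuousLinearMap.flip_apply, add_apply, smul_apply,
    ContinuousLinearMap.comp_apply, ContinuousLinearMap.inr_apply, fderiv_ray_apply_inr hΓ,
    map_smul] at hcurv ⊢
  rw [hcurv]
  module

theorem exists_ray_solution [CompleteSpace F] {Γ : E → E →L[ℝ] F →L[ℝ] F} {B : ℝ} {x : E} {e : F}
    (hΓ : ∀ t ∈ Icc (0 : ℝ) 1, ContinuousAt Γ (t • x))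
    (hB : ∀ t ∈ Icc (0 : ℝ) 1, ‖Γ (t • x)‖ ≤ B) (hsmall : B * ‖x‖ * (‖e‖ + 1) ≤ 1) :
    ∃ α : ℝ → F, α 0 = e ∧
      ∀ t ∈ Icc (0 : ℝ) 1, HasDerivWithinAt α (Γ (t • x) x (α t)) (Icc 0 1) t :=
  exists_linear_ode_solution (A := fun t ↦ Γ (t • x) x) e
    (fun t ht ↦ ((ContinuousAt.comp (f := fun s : ℝ ↦ s • x) (hΓ t ht)
      (by fun_prop)).clm_apply continuousAt_const).continuousWithinAt)
    (fun t ht ↦ (Γ (t • x)).le_of_opNorm_le (hB t ht) x) hsmall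

theorem hasFDerivAt_of_ray_solutions {Γ : E → E →L[ℝ] F →L[ℝ] F} {α : E → ℝ → F} {x : E}
    (hΓ : ∀ t ∈ Icc (0 : ℝ) 1, ContDiffAt ℝ 1 Γ (t • x))
    (hflat : ∀ t ∈ Icc (0 : ℝ) 1, IsFlatFormAt Γ (t • x))
    (hα : ∀ᶠ y in 𝓝 x, ∀ t ∈ Icc (0 : ℝ) 1,
      HasDerivWithinAt (α y) (Γ (t • y) y (α y t)) (Icc 0 1) t)
    (hα0 : ∀ᶠ y in 𝓝 x, α y 0 = α x 0) :
    HasFDerivAt (fun y ↦ α y 1) ((Γ x).flip (α x 1)) x := by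
  have hA : ∀ t ∈ Icc (0 : ℝ) 1,
      ContDiffAt ℝ 1 (fun p : ℝ × E ↦ Γ (p.1 • p.2) p.2) (t, x) := fun t ht ↦
    (ContDiffAt.comp (f := fun p : ℝ × E ↦ p.1 • p.2) (t, x) (hΓ t ht)
      (contDiffAt_fst.smul contDiffAt_snd)).clm_apply contDiffAt_snd
  have hderiv := hasFDerivAt_linear_ode (γ := fun t ↦ t • (Γ (t • x)).flip (α x t)) hA hα hα0
    (fun t ht ↦ (hflat t ht).hasDerivWithinAt_smul_flip ((hΓ t ht).differentiableAt one_ne_zero)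
      (hα.self_of_nhds t ht)) (zero_smul ℝ _)
  simpa only [one_smul] using hderiv

theorem exists_parallel_section_zero [CompleteSpace F] {Γ : E → E →L[ℝ] F →L[ℝ] F}
    (hΓ : ContDiffAt ℝ 1 Γ 0) (hflat : ∀ᶠ y in 𝓝 (0 : E), IsFlatFormAt Γ y) (e : F) :
    ∃ s : E → F, s 0 = e ∧ ∀ᶠ y in 𝓝 (0 : E), HasFDerivAt s ((Γ y).flip (s y)) y := by
  have hbound : ∀ᶠ y in 𝓝 (0 : E), ‖Γ y‖ < ‖Γ 0‖ + 1 :=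
    hΓ.continuousAt.norm.eventually_lt continuousAt_const (by simp)
  have hsmall : ∀ᶠ y in 𝓝 (0 : E), (‖Γ 0‖ + 1) * ‖y‖ * (‖e‖ + 1) < 1 :=
    ContinuousAt.eventually_lt (by fun_prop) continuousAt_const (by simp)
  obtain ⟨r, hr, hball⟩ := Metric.eventually_nhds_iff_ball.1
    ((hΓ.eventually (by simp)).and (hflat.and (hbound.and hsmall)))
  have hseg : ∀ y ∈ ball (0 : E) r, ∀ t ∈ Icc (0 : ℝ) 1, t • y ∈ ball (0 : E) r := fun y hy t ht ↦
    (convex_ball (0 : E) r).smul_mem_of_zero_mem (mem_ball_self hr) hy ht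
  choose! α hα0 hα using fun y (hy : y ∈ ball (0 : E) r) ↦ exists_ray_solution
    (fun t ht ↦ (hball _ (hseg y hy t ht)).1.continuousAt)
    (fun t ht ↦ (hball _ (hseg y hy t ht)).2.2.1.le) (hball y hy).2.2.2.le
  refine ⟨fun y ↦ α y 1, ?_, ?_⟩
  · have hconst := (convex_Icc (0 : ℝ) 1).norm_image_sub_le_of_norm_hasDerivWithin_le (C := 0)
      (hα 0 (mem_ball_self hr)) (by simp) (x := 0) (y := 1) (by simp) (by simp)
    rw [hα0 0 (mem_ball_self hr)] at hconst
    simpa [sub_eq_zero] using hconst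
  · filter_upwards [isOpen_ball.eventually_mem (mem_ball_self hr)] with x hx
    have hnear : ∀ᶠ y in 𝓝 x, y ∈ ball (0 : E) r := isOpen_ball.eventually_mem hx
    exact hasFDerivAt_of_ray_solutions (fun t ht ↦ (hball _ (hseg x hx t ht)).1)
      (fun t ht ↦ (hball _ (hseg x hx t ht)).2.1) (hnear.mono hα)
      (hnear.mono fun y hy ↦ (hα0 y hy).trans (hα0 x hx).symm)

/-- The linear case of Frobenius' theorem. -/
theorem exists_parallel_section [CompleteSpace F] {Γ : E → E →L[ℝ] F →L[ℝ] F} {x₀ : E}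
    (hΓ : ContDiffAt ℝ 1 Γ x₀) (hflat : ∀ᶠ y in 𝓝 x₀, IsFlatFormAt Γ y) (e : F) :
    ∃ s : E → F, s x₀ = e ∧ ∀ᶠ y in 𝓝 x₀, HasFDerivAt s ((Γ y).flip (s y)) y := by
  have hadd : Tendsto (· + x₀) (𝓝 0) (𝓝 x₀) := Continuous.tendsto' (by fun_prop) _ _ (zero_add x₀)
  have hsub : Tendsto (· - x₀) (𝓝 x₀) (𝓝 0) := Continuous.tendsto' (by fun_prop) _ _ (sub_self x₀)
  obtain ⟨s, hs0, hs⟩ := exists_parallel_section_zero (Γ := fun z ↦ Γ (z + x₀)) (e := e)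
    (ContDiffAt.comp (0 : E) (by simpa using hΓ) (contDiffAt_id.add contDiffAt_const))
    ((hadd.eventually hflat).mono fun y hy ↦ hy.comp_add_const)
  refine ⟨fun y ↦ s (y - x₀), by simpa using hs0, ?_⟩
  filter_upwards [hsub.eventually hs] with y hy
  rw [sub_add_cancel] at hy
  exact (HasFDerivAt.comp y hy ((hasFDerivAt_id y).sub_const x₀)).congr_fderiv
    (ContinuousLinearMap.comp_id _)

theorem contDiffAt_of_hasFDerivAt_flip {Γ : E → E →L[ℝ] F →L[ℝ] F} {s : E → F} {x₀ : E}
    (hΓ : ContDiffAt ℝ ∞ Γ x₀) (hs : ∀ᶠ y in 𝓝 x₀, HasFDerivAt s ((Γ y).flip (s y)) y) :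
    ContDiffAt ℝ ∞ s x₀ := by
  rw [contDiffAt_infty]
  intro k
  induction k with
  | zero =>
    rw [Nat.cast_zero, contDiffAt_zero]
    exact ⟨_, hs, fun y hy ↦ (HasFDerivAt.continuousAt hy).continuousWithinAt⟩
  | succ k ih =>
    rw [Nat.cast_succ, contDiffAt_succ_iff_hasFDerivAt]
    have hΓflip : ContDiffAt ℝ k (fun y ↦ (Γ y).flip) x₀ :=
      (ContinuousLinearMap.flipₗᵢ ℝ E F F).contDiff.contDiffAt.comp x₀ (contDiffAt_infty.1 hΓ k)
    exact ⟨fun y ↦ (Γ y).flip (s y), ⟨_, hs, fun y hy ↦ hy⟩, hΓflip.clm_apply ih⟩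

end LinearFrobenius

section AffineCoordinates

variable {E F : Type*} [NormedAddCommGroup E] [NormedSpace ℝ E]
  [NormedAddCommGroup F] [NormedSpace ℝ F]

theorem contDiffOn_infty_of_hasFDerivAt {f : E → F} {f' : E → E →L[ℝ] F} {V : Set E}
    (hV : IsOpen V) (hf : ∀ y ∈ V, HasFDerivAt f (f' y) y) (hf' : ContDiffOn ℝ ∞ f' V) :
    ContDiffOn ℝ ∞ f V := by
  rw [contDiffOn_infty_iff_fderiv_of_isOpen hV]
  exact ⟨fun y hy ↦ (hf y hy).differentiableAt.differentiableWithinAt,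
    hf'.congr fun y hy ↦ (hf y hy).fderiv⟩

/-- The connection form on `E →L[ℝ] E` whose parallel sections are the `E`-valued one-forms that
are parallel for the affine connection with Christoffel symbol `C`. -/
def coframeForm (C : E → E →L[ℝ] E →L[ℝ] E) (y : E) : E →L[ℝ] (E →L[ℝ] E) →L[ℝ] E →L[ℝ] E :=
  (ContinuousLinearMap.compL ℝ E E E).flip ∘L C y

theorem coframeForm_apply (C : E → E →L[ℝ] E →L[ℝ] E) (y u : E) (θ : E →L[ℝ] E) :
    coframeForm C y u θ = θ ∘L C y u :=
  rfl

theorem contDiffAt_coframeForm {C : E → E →L[ℝ] E →L[ℝ] E} {k : WithTop ℕ∞} {y : E}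
    (hC : ContDiffAt ℝ k C y) : ContDiffAt ℝ k (coframeForm C) y :=
  contDiffAt_const.clm_comp hC

theorem fderiv_coframeForm_apply {C : E → E →L[ℝ] E →L[ℝ] E} {y : E}
    (hC : DifferentiableAt ℝ C y) (u v : E) (θ : E →L[ℝ] E) :
    fderiv ℝ (coframeForm C) y u v θ = θ ∘L fderiv ℝ C y u v := by
  have hcomp : HasFDerivAt (coframeForm C) _ y :=
    (hasFDerivAt_const (ContinuousLinearMap.compL ℝ E E E).flip y).clm_comp hC.hasFDerivAt
  rw [hcomp.fderiv]
  simp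

theorem isFlatFormAt_coframeForm {C : E → E →L[ℝ] E →L[ℝ] E} {y : E} (hC : DifferentiableAt ℝ C y)
    (hcurv : ∀ u v w,
      fderiv ℝ C y u v w + C y u (C y v w) = fderiv ℝ C y v u w + C y v (C y u w)) :
    IsFlatFormAt (coframeForm C) y := by
  intro u v
  ext θ w
  simpa [fderiv_coframeForm_apply hC, coframeForm_apply] using congr(θ $(hcurv u v w))

theorem exists_parallel_coframe [CompleteSpace E] {C : E → E →L[ℝ] E →L[ℝ] E} {x₀ : E}
    (hC : ∀ᶠ y in 𝓝 x₀, ContDiffAt ℝ ∞ C y)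
    (hcurv : ∀ᶠ y in 𝓝 x₀, ∀ u v w,
      fderiv ℝ C y u v w + C y u (C y v w) = fderiv ℝ C y v u w + C y v (C y u w)) :
    ∃ θ : E → E →L[ℝ] E, θ x₀ = ContinuousLinearMap.id ℝ E ∧ ∀ᶠ y in 𝓝 x₀,
      ContDiffAt ℝ ∞ θ y ∧ ∀ u, fderiv ℝ θ y u = θ y ∘L C y u := by
  have hflat : ∀ᶠ y in 𝓝 x₀, IsFlatFormAt (coframeForm C) y := by
    filter_upwards [hC, hcurv] with y hCy using
      isFlatFormAt_coframeForm (hCy.differentiableAt (by simp))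
  obtain ⟨θ, hθ0, hθ⟩ := exists_parallel_section
    ((contDiffAt_coframeForm hC.self_of_nhds).of_le (by simp)) hflat (ContinuousLinearMap.id ℝ E)
  refine ⟨θ, hθ0, ?_⟩
  filter_upwards [hθ, hθ.eventually_nhds, hC] with y hθy hθnear hCy
  refine ⟨contDiffAt_of_hasFDerivAt_flip (contDiffAt_coframeForm hCy) hθnear, fun u ↦ ?_⟩
  rw [hθy.fderiv]
  rfl

theorem exists_openPartialHomeomorph_of_contDiffOn [CompleteSpace E] {f : E → E} {V : Set E}
    (hV : IsOpen V) (hf : ContDiffOn ℝ ∞ f V) (hinv : ∀ y ∈ V, (fderiv ℝ f y).IsInvertible) {x₀ : E}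
    (hx₀ : x₀ ∈ V) :
    ∃ τ : OpenPartialHomeomorph E E, x₀ ∈ τ.source ∧ τ.source ⊆ V ∧ ⇑τ = f ∧
      ContDiffOn ℝ ∞ τ.symm τ.target := by
  have hf' : ∀ y ∈ V, ContDiffAt ℝ ∞ f y ∧ ∃ e : E ≃L[ℝ] E, HasFDerivAt f (e : E →L[ℝ] E) y := by
    intro y hy
    have hfy := hf.contDiffAt (hV.mem_nhds hy)
    obtain ⟨e, he⟩ := hinv y hy
    exact ⟨hfy, e, he ▸ (hfy.differentiableAt (by simp)).hasFDerivAt⟩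
  obtain ⟨hfx₀, e, he⟩ := hf' x₀ hx₀
  have hsource : ((hfx₀.toOpenPartialHomeomorph f he (by simp)).restrOpen V hV).source ⊆ V :=
    fun y hy ↦ hy.2
  refine ⟨(hfx₀.toOpenPartialHomeomorph f he (by simp)).restrOpen V hV,
    ⟨hfx₀.mem_toOpenPartialHomeomorph_source he (by simp), hx₀⟩, hsource, rfl, fun z hz ↦ ?_⟩
  obtain ⟨hfz, e', he'⟩ := hf' _ (hsource (OpenPartialHomeomorph.map_target _ hz))
  exact (OpenPartialHomeomorph.contDiffAt_symm _ hz he' hfz).contDiffWithinAt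

theorem eventually_isInvertible [CompleteSpace E] {θ : E → E →L[ℝ] E} {y : E}
    (hθ : ContinuousAt θ y) (hinv : (θ y).IsInvertible) : ∀ᶠ z in 𝓝 y, (θ z).IsInvertible := by
  obtain ⟨e, he⟩ := hinv
  exact hθ.eventually (he ▸ e.nhds)

/-- A parallel coframe is closed because `C` is symmetric, so that it is the differential of an
affine coordinate system. -/
theorem exists_affine_openPartialHomeomorph [CompleteSpace E] {C : E → E →L[ℝ] E →L[ℝ] E} {x₀ : E}
    (hC : ∀ᶠ y in 𝓝 x₀, ContDiffAt ℝ ∞ C y) (hsymm : ∀ᶠ y in 𝓝 x₀, ∀ u v, C y u v = C y v u)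
    (hcurv : ∀ᶠ y in 𝓝 x₀, ∀ u v w,
      fderiv ℝ C y u v w + C y u (C y v w) = fderiv ℝ C y v u w + C y v (C y u w)) :
    ∃ τ : OpenPartialHomeomorph E E, x₀ ∈ τ.source ∧ ContDiffOn ℝ ∞ τ τ.source ∧
      ContDiffOn ℝ ∞ τ.symm τ.target ∧ ∀ y ∈ τ.source, (fderiv ℝ τ y).IsInvertible ∧
        ∀ u, fderiv ℝ (fderiv ℝ τ) y u = fderiv ℝ τ y ∘L C y u := by
  obtain ⟨θ, hθ0, hθ⟩ := exists_parallel_coframe hC hcurv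
  have hinv : ∀ᶠ y in 𝓝 x₀, (θ y).IsInvertible :=
    eventually_isInvertible hθ.self_of_nhds.1.continuousAt
      (hθ0 ▸ ⟨ContinuousLinearEquiv.refl ℝ E, rfl⟩)
  obtain ⟨r, hr, hball⟩ := Metric.eventually_nhds_iff_ball.1 (hθ.and (hsymm.and hinv))
  have hθsmooth : ContDiffOn ℝ ∞ θ (ball x₀ r) := fun y hy ↦ (hball y hy).1.1.contDiffWithinAt
  obtain ⟨η, hη⟩ := (convex_ball x₀ r).exists_forall_hasFDerivAt_of_fderiv_symmetric isOpen_ball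
    (hθsmooth.differentiableOn (by simp)) fun y hy u v ↦ by
      simp [(hball y hy).1.2, (hball y hy).2.1 u v]
  have hηsmooth := contDiffOn_infty_of_hasFDerivAt isOpen_ball hη hθsmooth
  obtain ⟨τ, hx₀, hτ, rfl, hτsymm⟩ := exists_openPartialHomeomorph_of_contDiffOn isOpen_ball
    hηsmooth (fun y hy ↦ (hη y hy).fderiv ▸ (hball y hy).2.2) (mem_ball_self hr)
  refine ⟨τ, hx₀, hηsmooth.mono hτ, hτsymm, fun y hy ↦ ?_⟩
  have hfderiv : fderiv ℝ τ =ᶠ[𝓝 y] θ :=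
    (isOpen_ball.eventually_mem (hτ hy)).mono fun z hz ↦ (hη z hz).fderiv
  rw [hfderiv.fderiv_eq, hfderiv.eq_of_nhds]
  exact ⟨(hball y (hτ hy)).2.2, (hball y (hτ hy)).1.2⟩

/-- The frame dual to a parallel coframe is parallel. -/
theorem hasFDerivAt_inverse_apply_of_parallel [CompleteSpace E] {θ : E → E →L[ℝ] E}
    {C : E →L[ℝ] E →L[ℝ] E} {y : E} (hθ : DifferentiableAt ℝ θ y) (hinv : (θ y).IsInvertible)
    (hpar : ∀ u, fderiv ℝ θ y u = θ y ∘L C u) (v : E) :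
    HasFDerivAt (fun z ↦ (θ z).inverse v) (-C.flip ((θ y).inverse v)) y := by
  have hinverse : DifferentiableAt ℝ ContinuousLinearMap.inverse (θ y) := by
    obtain ⟨e, he⟩ := hinv
    exact he ▸ (contDiffAt_map_inverse e (n := 1)).differentiableAt one_ne_zero
  have hW : DifferentiableAt ℝ (fun z ↦ (θ z).inverse v) y :=
    (hinverse.comp y hθ).clm_apply (differentiableAt_const v)
  have hconst : HasFDerivAt (fun z ↦ θ z ((θ z).inverse v)) (0 : E →L[ℝ] E) y := by
    refine (hasFDerivAt_const v y).congr_of_eventuallyEq ?_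
    filter_upwards [eventually_isInvertible hθ.continuousAt hinv] with z hz
    exact hz.self_apply_inverse v
  have hderiv := (hθ.hasFDerivAt.clm_apply hW.hasFDerivAt).unique hconst
  refine hW.hasFDerivAt.congr_fderiv ?_
  ext u
  have hu := congr($hderiv u)
  simp only [add_apply, ContinuousLinearMap.comp_apply, ContinuousLinearMap.flip_apply, hpar,
    ← map_add, zero_apply] at hu
  have := hinv.injective (hu.trans (map_zero (θ y)).symm)
  exact eq_neg_of_add_eq_zero_left this

end AffineCoordinates

section CovariantDerivative

variable {𝕜 E H F M : Type*} [NontriviallyNormedField 𝕜] [NormedAddCommGroup E] [NormedSpace 𝕜 E]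
  [TopologicalSpace H] {I : ModelWithCorners 𝕜 E H} [TopologicalSpace M] [ChartedSpace H M]
  [NormedAddCommGroup F] [NormedSpace 𝕜 F] {V : M → Type*}
  [TopologicalSpace (Bundle.TotalSpace F V)] [∀ x, AddCommGroup (V x)] [∀ x, Module 𝕜 (V x)]
  [∀ x, TopologicalSpace (V x)] [∀ x, IsTopologicalAddGroup (V x)] [∀ x, ContinuousSMul 𝕜 (V x)]
  [FiberBundle F V] {D : CovariantDerivative I F V} {x : M}

theorem covariantDerivative_congr {σ σ' : Π x : M, V x} (hσ : MDiffAt (T% σ) x)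
    (h : ∀ᶠ y in 𝓝 x, σ' y = σ y) : D σ' x = D σ x := by
  refine D.isCovariantDerivativeOnUniv.congr_of_eventuallyEq (hσ.congr_of_eventuallyEq ?_) hσ
    univ_mem h
  filter_upwards [h] with y hy
  rw [hy]

theorem covariantDerivative_sum_smul [VectorBundle 𝕜 F V] {ι : Type*} (t : Finset ι)
    {f : ι → M → 𝕜} {σ : ι → Π x : M, V x} (hf : ∀ i ∈ t, MDiffAt (f i) x)
    (hσ : ∀ i ∈ t, MDiffAt (T% (σ i)) x) :
    D (fun y ↦ ∑ i ∈ t, f i y • σ i y) x =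
      ∑ i ∈ t, (f i x • D (σ i) x + (mvfderiv I (f i) x).smulRight (σ i x)) := by
  classical
  induction t using Finset.induction_on with
  | empty => exact congrFun D.zero x
  | insert a t ha ih =>
    rw [Finset.forall_mem_insert] at hf hσ
    have hfσ : ∀ i ∈ t, MDiffAt (T% (f i • σ i)) x := fun i hi ↦
      (hf.2 i hi).smul_section (hσ.2 i hi)
    simp only [Finset.sum_insert ha, ← ih hf.2 hσ.2,
      ← D.isCovariantDerivativeOnUniv.leibniz hσ.1 hf.1]
    exact D.isCovariantDerivativeOnUniv.add (hf.1.smul_section hσ.1) (.sum_section hfσ)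

end CovariantDerivative

section SmoothCovariantDerivative

variable {E H F M : Type*} [NormedAddCommGroup E] [NormedSpace ℝ E] [FiniteDimensional ℝ E]
  [TopologicalSpace H] {I : ModelWithCorners ℝ E H} [TopologicalSpace M] [ChartedSpace H M]
  [IsManifold I ∞ M] [T2Space M] [NormedAddCommGroup F] [NormedSpace ℝ F] {V : M → Type*}
  [TopologicalSpace (Bundle.TotalSpace F V)] [∀ x, AddCommGroup (V x)] [∀ x, Module ℝ (V x)]
  [∀ x, TopologicalSpace (V x)] [∀ x, IsTopologicalAddGroup (V x)] [∀ x, ContinuousSMul ℝ (V x)]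
  [FiberBundle F V] [VectorBundle ℝ F V] {D : CovariantDerivative I F V} {x : M}

theorem contMDiffAt_covariantDerivative_apply (hD : D.ContMDiffCovariantDerivative ∞) {U : Set M}
    (hU : IsOpen U) (hxU : x ∈ U) {X : Π x : M, TangentSpace I x} {σ : Π x : M, V x}
    (hσ : CMDiff[U] ∞ (T% σ)) (hX : CMDiffAt ∞ (T% X) x) :
    CMDiffAt ∞ (T% fun y ↦ D σ y (X y)) x := by
  -- `D.ContMDiffCovariantDerivative` only speaks of global sections, so cut `σ` off near `x`
  obtain ⟨f, -, hf⟩ := (SmoothBumpFunction.nhds_basis_tsupport (I := I) x).mem_iff.1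
    (hU.mem_nhds hxU)
  have hfσ : CMDiff ∞ (T% ((f : M → ℝ) • σ)) :=
    ContMDiffOn.smul_section_of_tsupport f.contMDiff.contMDiffOn hU hf hσ
  have hDfσ := (hD.contMDiff.contMDiff (σ := (f : M → ℝ) • σ) hfσ.contMDiffOn).contMDiffAt
    (x := x) univ_mem
  refine (ContMDiffAt.clm_bundle_apply (b := fun y : M ↦ y) hDfσ hX).congr_of_eventuallyEq ?_
  filter_upwards [f.eventuallyEq_one.eventually_nhds, hU.mem_nhds hxU] with y hfy hyU
  have hσy : MDiffAt (T% σ) y :=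
    ((hσ y hyU).contMDiffAt (hU.mem_nhds hyU)).mdifferentiableAt (by simp)
  have hD_eq : D ((f : M → ℝ) • σ) y = D σ y :=
    covariantDerivative_congr hσy (hfy.mono fun z hz ↦ by simp [hz])
  rw [hD_eq]

end SmoothCovariantDerivative

section ChartFields

variable {E : Type*} [NormedAddCommGroup E] [NormedSpace ℝ E]
  {M : Type*} [TopologicalSpace M] [ChartedSpace E M]
  {η : OpenPartialHomeomorph M E} {x : M}

/-- The vector field on `M` whose representation in the chart `η` is `W`. -/
def chartLift (η : OpenPartialHomeomorph M E) (W : E → E) : Π x : M, TangentSpace 𝓘(ℝ, E) x :=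
  VectorField.mpullback 𝓘(ℝ, E) 𝓘(ℝ, E) η W

/-- The vector field on `M` whose representation in the chart `η` is constant, equal to `v`; the
coordinate fields are the `chartField η v` with `v` in the standard basis. -/
def chartField (η : OpenPartialHomeomorph M E) (v : E) : Π x : M, TangentSpace 𝓘(ℝ, E) x :=
  chartLift η fun _ ↦ v

/-- The representation of a vector field in the chart `η`, as a map on the model space. -/
def chartRep (η : OpenPartialHomeomorph M E) (Z : Π x : M, TangentSpace 𝓘(ℝ, E) x) : E → E :=
  VectorField.mpullback 𝓘(ℝ, E) 𝓘(ℝ, E) η.symm Z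

theorem chartLift_eq_chartField (η : OpenPartialHomeomorph M E) (W : E → E) (x : M) :
    chartLift η W x = chartField η (W (η x)) x :=
  rfl

theorem chartField_apply (η : OpenPartialHomeomorph M E) (v : E) (x : M) :
    chartField η v x = (mfderiv 𝓘(ℝ, E) 𝓘(ℝ, E) η x).inverse v :=
  rfl

theorem chartField_add (u v : E) : chartField η (u + v) x = chartField η u x + chartField η v x :=
  map_add (mfderiv 𝓘(ℝ, E) 𝓘(ℝ, E) η x).inverse u v

theorem chartField_zero : chartField η (0 : E) x = 0 :=
  map_zero (mfderiv 𝓘(ℝ, E) 𝓘(ℝ, E) η x).inverse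

theorem chartField_smul (c : ℝ) (v : E) : chartField η (c • v) x = c • chartField η v x :=
  map_smul (mfderiv 𝓘(ℝ, E) 𝓘(ℝ, E) η x).inverse c v

theorem chartField_sum {ι : Type*} (s : Finset ι) (v : ι → E) :
    chartField η (∑ i ∈ s, v i) x = ∑ i ∈ s, chartField η (v i) x :=
  map_sum (mfderiv 𝓘(ℝ, E) 𝓘(ℝ, E) η x).inverse v s

theorem two_le_infty : (2 : ℕ∞ω) ≤ ∞ :=
  WithTop.coe_le_coe.2 le_top

theorem mdifferentiableAt_vectorField {W : Π y : E, TangentSpace 𝓘(ℝ, E) y} {y : E}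
    (hW : DifferentiableAt ℝ W y) : MDiffAt (T% W) y := by
  rw [mdifferentiableAt_totalSpace]
  exact ⟨mdifferentiableAt_id, by simpa using! hW.mdifferentiableAt⟩

theorem mlieBracket_const (u v y : E) :
    VectorField.mlieBracket 𝓘(ℝ, E) (fun _ : E ↦ u) (fun _ : E ↦ v) y = 0 := by
  have h : VectorField.lieBracketWithin ℝ (fun _ : E ↦ u) (fun _ : E ↦ v) univ y = 0 := by
    simp [VectorField.lieBracketWithin_eq]
  exact (congrFun VectorField.mlieBracketWithin_univ y).symm.trans
    ((congrFun VectorField.mlieBracketWithin_eq_lieBracketWithin y).trans h)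

section

variable (hη : η ∈ IsManifold.maximalAtlas 𝓘(ℝ, E) ∞ M)
include hη

theorem mdifferentiable_of_mem_maximalAtlas : η.MDifferentiable 𝓘(ℝ, E) 𝓘(ℝ, E) :=
  ⟨(contMDiffOn_of_mem_maximalAtlas hη).mdifferentiableOn (by simp),
    (contMDiffOn_symm_of_mem_maximalAtlas hη).mdifferentiableOn (by simp)⟩

theorem trans_mem_maximalAtlas [IsManifold 𝓘(ℝ, E) ∞ M] {τ : OpenPartialHomeomorph E E}
    (hτ : ContDiffOn ℝ ∞ τ τ.source) (hτ_symm : ContDiffOn ℝ ∞ τ.symm τ.target) :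
    η.trans τ ∈ IsManifold.maximalAtlas 𝓘(ℝ, E) ∞ M := by
  refine OpenPartialHomeomorph.mem_maximalAtlas_of_contMDiffOn _ ?_ ?_
  · rw [OpenPartialHomeomorph.trans_source]
    exact hτ.contMDiffOn.comp
      ((contMDiffOn_of_mem_maximalAtlas hη).mono inter_subset_left) inter_subset_right
  · rw [OpenPartialHomeomorph.trans_target]
    exact (contMDiffOn_symm_of_mem_maximalAtlas hη).comp
      (hτ_symm.contMDiffOn.mono inter_subset_left) inter_subset_right

variable (hx : x ∈ η.source)
include hx

theorem isInvertible_mfderiv_of_mem_maximalAtlas :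
    (mfderiv 𝓘(ℝ, E) 𝓘(ℝ, E) η x).IsInvertible :=
  ⟨(mdifferentiable_of_mem_maximalAtlas hη).mfderiv hx, rfl⟩

theorem mfderiv_symm_eq_inverse :
    mfderiv 𝓘(ℝ, E) 𝓘(ℝ, E) η.symm (η x) = (mfderiv 𝓘(ℝ, E) 𝓘(ℝ, E) η x).inverse := by
  have hmdiff := mdifferentiable_of_mem_maximalAtlas hη
  have hcomp := hmdiff.comp_symm_deriv (η.map_source hx)
  rw [η.left_inv hx] at hcomp
  exact (ContinuousLinearMap.inverse_eq hcomp (hmdiff.symm_comp_deriv hx)).symm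

theorem mfderiv_chartField (v : E) :
    mfderiv 𝓘(ℝ, E) 𝓘(ℝ, E) η x (chartField η v x) = v :=
  (isInvertible_mfderiv_of_mem_maximalAtlas hη hx).self_apply_inverse v

theorem chartField_injective : Function.Injective fun v ↦ chartField η v x :=
  Function.LeftInverse.injective (mfderiv_chartField hη hx)

theorem exists_chartField_eq (z : TangentSpace 𝓘(ℝ, E) x) : ∃ v, chartField η v x = z :=
  ⟨_, (isInvertible_mfderiv_of_mem_maximalAtlas hη hx).inverse_apply_self z⟩

theorem chartField_chartRep (Z : Π x : M, TangentSpace 𝓘(ℝ, E) x) :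
    chartField η (chartRep η Z (η x)) x = Z x := by
  have hinv := isInvertible_mfderiv_of_mem_maximalAtlas hη hx
  rw [chartField_apply, chartRep, VectorField.mpullback_apply, mfderiv_symm_eq_inverse hη hx,
    η.left_inv hx, hinv.inverse_inverse]
  exact hinv.inverse_apply_self (Z x)

theorem chartField_trans {τ : OpenPartialHomeomorph E E} (hτ : DifferentiableAt ℝ τ (η x)) (v : E) :
    chartField (η.trans τ) v x = chartField η ((fderiv ℝ τ (η x)).inverse v) x := by
  have hcomp := mfderiv_comp x hτ.mdifferentiableAt
    ((mdifferentiable_of_mem_maximalAtlas hη).mdifferentiableAt hx)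
  rw [mfderiv_eq_fderiv] at hcomp
  rw [chartField_apply, chartField_apply, OpenPartialHomeomorph.coe_trans, hcomp]
  exact (isInvertible_mfderiv_of_mem_maximalAtlas hη hx).inverse_comp_apply_of_right

section

variable {F : Type*} [NormedAddCommGroup F] [NormedSpace ℝ F] {f : E → F}

theorem mdifferentiableAt_comp_chart (hf : DifferentiableAt ℝ f (η x)) :
    MDiffAt (fun y ↦ f (η y)) x :=
  hf.mdifferentiableAt.comp x ((mdifferentiable_of_mem_maximalAtlas hη).mdifferentiableAt hx)

theorem mvfderiv_comp_chart (hf : DifferentiableAt ℝ f (η x)) (u : E) :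
    mvfderiv 𝓘(ℝ, E) (fun y ↦ f (η y)) x (chartField η u x) = fderiv ℝ f (η x) u := by
  have hcomp := mfderiv_comp x hf.mdifferentiableAt
    ((mdifferentiable_of_mem_maximalAtlas hη).mdifferentiableAt hx)
  change mfderiv 𝓘(ℝ, E) 𝓘(ℝ, F) (f ∘ η) x (chartField η u x) = _
  rw [hcomp, ContinuousLinearMap.comp_apply, mfderiv_chartField hη hx, mfderiv_eq_fderiv]
  rfl

end

variable [IsManifold 𝓘(ℝ, E) ∞ M] [CompleteSpace E]

theorem contMDiffAt_chartField (v : E) : CMDiffAt ∞ (T% (chartField η v)) x :=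
  ContMDiffAt.mpullback_vectorField_preimage (n := ∞)
    (contMDiffAt_vectorSpace_iff_contDiffAt.2 contDiffAt_const)
    (contMDiffAt_of_mem_maximalAtlas hη hx) (isInvertible_mfderiv_of_mem_maximalAtlas hη hx)
    (by simp)

theorem mdifferentiableAt_chartField (v : E) : MDiffAt (T% (chartField η v)) x :=
  (contMDiffAt_chartField hη hx v).mdifferentiableAt (by simp)

theorem mdifferentiableAt_chartLift {W : E → E} (hW : DifferentiableAt ℝ W (η x)) :
    MDiffAt (T% (chartLift η W)) x :=
  MDifferentiableAt.mpullback_vectorField (n := ∞) (mdifferentiableAt_vectorField hW)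
    (contMDiffAt_of_mem_maximalAtlas hη hx) (isInvertible_mfderiv_of_mem_maximalAtlas hη hx)
    two_le_infty

theorem contDiffAt_chartRep {Z : Π x : M, TangentSpace 𝓘(ℝ, E) x} (hZ : CMDiffAt ∞ (T% Z) x) :
    ContDiffAt ℝ ∞ (chartRep η Z) (η x) := by
  refine contMDiffAt_vectorSpace_iff_contDiffAt.1 <|
    ContMDiffAt.mpullback_vectorField_preimage (n := ∞) (by rwa [η.left_inv hx])
      (contMDiffAt_symm_of_mem_maximalAtlas hη (η.map_source hx)) ?_ (by simp)
  rw [mfderiv_symm_eq_inverse hη hx]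
  exact (isInvertible_mfderiv_of_mem_maximalAtlas hη hx).inverse

theorem mlieBracket_chartField (u v : E) :
    VectorField.mlieBracket 𝓘(ℝ, E) (chartField η u) (chartField η v) x = 0 := by
  have htwo : minSmoothness ℝ 2 ≤ ∞ := by
    rw [minSmoothness_of_isRCLikeNormedField]
    exact two_le_infty
  have : IsManifold 𝓘(ℝ, E) (minSmoothness ℝ 2) M := .of_le htwo
  have hpull := VectorField.mpullback_mlieBracket (n := ∞)
    (mdifferentiableAt_vectorField (differentiableAt_const u))
    (mdifferentiableAt_vectorField (differentiableAt_const v))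
    (contMDiffAt_of_mem_maximalAtlas hη hx) htwo
  rw [VectorField.mpullback_apply, mlieBracket_const, map_zero] at hpull
  exact hpull.symm

end

end ChartFields

theorem hasFDerivAt_apply_apply {E F G H : Type*} [NormedAddCommGroup E] [NormedSpace ℝ E]
    [NormedAddCommGroup F] [NormedSpace ℝ F] [NormedAddCommGroup G] [NormedSpace ℝ G]
    [NormedAddCommGroup H] [NormedSpace ℝ H] {C : E → F →L[ℝ] G →L[ℝ] H} {y : E}
    (hC : DifferentiableAt ℝ C y) (v : F) (w : G) :
    HasFDerivAt (fun z ↦ C z v w) (((fderiv ℝ C y).flip v).flip w) y := by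
  refine ((hC.hasFDerivAt.clm_apply (hasFDerivAt_const v _)).clm_apply
    (hasFDerivAt_const w _)).congr_fderiv ?_
  ext u
  simp

section Christoffel

variable {E : Type*} [NormedAddCommGroup E] [NormedSpace ℝ E] [FiniteDimensional ℝ E]
  {M : Type*} [TopologicalSpace M] [ChartedSpace E M] [IsManifold 𝓘(ℝ, E) ∞ M]
  {D : CovariantDerivative 𝓘(ℝ, E) E (TangentSpace 𝓘(ℝ, E) : M → Type _)}
  {η : OpenPartialHomeomorph M E} {x : M}

variable (D) in
/-- The Christoffel symbol of the connection `D` in the chart `η`, as a bilinear map: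
`christoffel D η y u v` represents `∇_u v` for the constant fields `u` and `v`. -/
def christoffel (η : OpenPartialHomeomorph M E) (y : E) : E →L[ℝ] E →L[ℝ] E :=
  (Module.finBasis ℝ E).constrL fun i ↦ (Module.finBasis ℝ E).constrL fun j ↦
    chartRep η (fun x ↦ D (chartField η (Module.finBasis ℝ E j)) x
      (chartField η (Module.finBasis ℝ E i) x)) y

theorem contDiffAt_constrL {ι F : Type*} [Finite ι] [NormedAddCommGroup F] [NormedSpace ℝ F]
    {k : WithTop ℕ∞} (b : Module.Basis ι ℝ E) {f : ι → E → F} {y : E}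
    (hf : ∀ i, ContDiffAt ℝ k (f i) y) : ContDiffAt ℝ k (fun z ↦ b.constrL fun i ↦ f i z) y := by
  cases nonempty_fintype ι
  have hsum : ∀ c : ι → F,
      b.constrL c = ∑ i, (b.coord i).toContinuousLinearMap.smulRight (c i) := fun c ↦ by
    ext v
    simp [b.constrL_apply]
  simp only [hsum]
  exact ContDiffAt.sum fun i _ ↦ contDiffAt_const.smulRight (hf i)

theorem sum_smul_covariantDerivative_basis (hη : η ∈ IsManifold.maximalAtlas 𝓘(ℝ, E) ∞ M)
    (hx : x ∈ η.source) (u w : E) :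
    ∑ j, (Module.finBasis ℝ E).repr w j •
        D (chartField η (Module.finBasis ℝ E j)) x (chartField η u x) =
      chartField η (christoffel D η (η x) u w) x := by
  set b := Module.finBasis ℝ E with hb
  have hu : chartField η u x = ∑ i, b.repr u i • chartField η (b i) x := by
    simp only [← chartField_smul, ← chartField_sum, b.sum_repr]
  have hΓ : christoffel D η (η x) u w = ∑ i, b.repr u i • ∑ j, b.repr w j •
      chartRep η (fun x ↦ D (chartField η (b j)) x (chartField η (b i) x)) (η x) := by
    simp [christoffel, Module.Basis.constrL_apply, hb]
  simp only [hu, hΓ, map_sum, map_smul, chartField_sum, chartField_smul,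
    chartField_chartRep hη hx, Finset.smul_sum]
  rw [Finset.sum_comm]
  exact Finset.sum_congr rfl fun i _ ↦ Finset.sum_congr rfl fun j _ ↦ smul_comm _ _ _

theorem covariantDerivative_chartLift (hη : η ∈ IsManifold.maximalAtlas 𝓘(ℝ, E) ∞ M)
    (hx : x ∈ η.source) {W : E → E} (hW : DifferentiableAt ℝ W (η x)) (u : E) :
    D (chartLift η W) x (chartField η u x) =
      chartField η (fderiv ℝ W (η x) u + christoffel D η (η x) u (W (η x))) x := by
  have := FiniteDimensional.complete ℝ E
  set b := Module.finBasis ℝ E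
  have hcoord : ∀ j, HasFDerivAt (fun y ↦ b.repr (W y) j)
      ((b.coord j).toContinuousLinearMap ∘L fderiv ℝ W (η x)) (η x) := fun j ↦
    (b.coord j).toContinuousLinearMap.hasFDerivAt.comp (η x) hW.hasFDerivAt
  have hsum : chartLift η W = fun y ↦ ∑ j, b.repr (W (η y)) j • chartField η (b j) y := by
    funext y
    simp only [← chartField_smul, ← chartField_sum, b.sum_repr, chartLift_eq_chartField]
  have hderiv : ∀ j, mvfderiv 𝓘(ℝ, E) (fun y ↦ b.repr (W (η y)) j) x (chartField η u x) =
      b.repr (fderiv ℝ W (η x) u) j := fun j ↦ by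
    rw [mvfderiv_comp_chart hη hx (hcoord j).differentiableAt, (hcoord j).fderiv]
    rfl
  rw [hsum, covariantDerivative_sum_smul Finset.univ
    (fun j _ ↦ mdifferentiableAt_comp_chart hη hx (hcoord j).differentiableAt)
    (fun j _ ↦ mdifferentiableAt_chartField hη hx (b j)), sum_apply]
  simp only [add_apply, smul_apply, ContinuousLinearMap.smulRight_apply, hderiv]
  rw [Finset.sum_add_distrib, sum_smul_covariantDerivative_basis hη hx, add_comm, chartField_add]
  simp only [← chartField_smul, ← chartField_sum, b.sum_repr]

theorem covariantDerivative_chartField (hη : η ∈ IsManifold.maximalAtlas 𝓘(ℝ, E) ∞ M)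
    (hx : x ∈ η.source) (u v : E) :
    D (chartField η v) x (chartField η u x) = chartField η (christoffel D η (η x) u v) x := by
  refine (covariantDerivative_chartLift hη hx (differentiableAt_const v) u).trans ?_
  simp

theorem contDiffAt_christoffel [T2Space M] (hD : D.ContMDiffCovariantDerivative ∞)
    (hη : η ∈ IsManifold.maximalAtlas 𝓘(ℝ, E) ∞ M) (hx : x ∈ η.source) :
    ContDiffAt ℝ ∞ (christoffel D η) (η x) := by
  have := FiniteDimensional.complete ℝ E
  exact contDiffAt_constrL _ fun i ↦ contDiffAt_constrL _ fun j ↦ contDiffAt_chartRep hη hx <|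
    contMDiffAt_covariantDerivative_apply hD η.open_source hx
      (fun y hy ↦ (contMDiffAt_chartField hη hy _).contMDiffWithinAt)
      (contMDiffAt_chartField hη hx _)

theorem covariantDerivative_covariantDerivative_chartField [T2Space M]
    (hD : D.ContMDiffCovariantDerivative ∞) (hη : η ∈ IsManifold.maximalAtlas 𝓘(ℝ, E) ∞ M)
    (hx : x ∈ η.source) (u v w : E) :
    D (fun y ↦ D (chartField η w) y (chartField η v y)) x (chartField η u x) =
      chartField η (fderiv ℝ (christoffel D η) (η x) u v w +
        christoffel D η (η x) u (christoffel D η (η x) v w)) x := by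
  have := FiniteDimensional.complete ℝ E
  have hΓ := hasFDerivAt_apply_apply
    ((contDiffAt_christoffel hD hη hx).differentiableAt (by simp)) v w
  have hlift : D (fun y ↦ D (chartField η w) y (chartField η v y)) x =
      D (chartLift η fun y ↦ christoffel D η y v w) x :=
    covariantDerivative_congr (mdifferentiableAt_chartLift hη hx hΓ.differentiableAt)
      ((η.open_source.eventually_mem hx).mono fun y hy ↦ by
        rw [covariantDerivative_chartField hη hy, chartLift_eq_chartField])
  rw [hlift, covariantDerivative_chartLift hη hx hΓ.differentiableAt, hΓ.fderiv,
    ContinuousLinearMap.flip_apply, ContinuousLinearMap.flip_apply]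

theorem christoffel_symm (htor : D.torsion = 0) (hη : η ∈ IsManifold.maximalAtlas 𝓘(ℝ, E) ∞ M)
    (hx : x ∈ η.source) (u v : E) :
    christoffel D η (η x) u v = christoffel D η (η x) v u := by
  have := FiniteDimensional.complete ℝ E
  have h := D.torsion_eq_zero_iff.1 htor (mdifferentiableAt_chartField hη hx u)
    (mdifferentiableAt_chartField hη hx v)
  rw [mlieBracket_chartField hη hx, sub_eq_zero, covariantDerivative_chartField hη hx,
    covariantDerivative_chartField hη hx] at h
  exact chartField_injective hη hx h

variable (D) in
/-- The chart `η` is affine for `D`: the vector fields which are constant in `η` are parallel. -/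
def IsParallelChart (η : OpenPartialHomeomorph M E) : Prop :=
  ∀ x ∈ η.source, ∀ v, D (chartField η v) x = 0

/-- The coordinate fields of `η.trans τ` are the frame dual to the parallel coframe `dτ`. -/
theorem isParallelChart_trans (hη : η ∈ IsManifold.maximalAtlas 𝓘(ℝ, E) ∞ M)
    {τ : OpenPartialHomeomorph E E} (hτ : ContDiffOn ℝ ∞ τ τ.source)
    (hpar : ∀ y ∈ τ.source, (fderiv ℝ τ y).IsInvertible ∧
      ∀ u, fderiv ℝ (fderiv ℝ τ) y u = fderiv ℝ τ y ∘L christoffel D η y u) :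
    IsParallelChart D (η.trans τ) := by
  intro x hx v
  have := FiniteDimensional.complete ℝ E
  have hxτ : η x ∈ τ.source := hx.2
  have hdτ : ∀ y ∈ τ.source, DifferentiableAt ℝ τ y := fun y hy ↦
    (hτ.differentiableOn (by simp)).differentiableAt (τ.open_source.mem_nhds hy)
  have hddτ : DifferentiableAt ℝ (fderiv ℝ τ) (η x) :=
    ((hτ.fderiv_of_isOpen τ.open_source (m := ∞) (by simp)).differentiableOn
      (by simp)).differentiableAt (τ.open_source.mem_nhds hxτ)
  have hframe := hasFDerivAt_inverse_apply_of_parallel hddτ (hpar _ hxτ).1 (hpar _ hxτ).2 v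
  have hlift : D (chartField (η.trans τ) v) x =
      D (chartLift η fun y ↦ (fderiv ℝ τ y).inverse v) x :=
    covariantDerivative_congr (mdifferentiableAt_chartLift hη hx.1 hframe.differentiableAt) <|
      ((η.trans τ).open_source.eventually_mem hx).mono fun y hy ↦ by
        rw [chartField_trans hη hy.1 (hdτ _ hy.2), chartLift_eq_chartField]
  ext z
  obtain ⟨u, rfl⟩ := exists_chartField_eq hη hx.1 z
  rw [hlift, covariantDerivative_chartLift hη hx.1 hframe.differentiableAt, hframe.fderiv,
    neg_apply, ContinuousLinearMap.flip_apply, neg_add_cancel, chartField_zero]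
  rfl

end Christoffel

section FlatConnection

variable {n : ℕ} {M : Type*} [TopologicalSpace M] [T2Space M]
  [ChartedSpace (EuclideanSpace ℝ (Fin n)) M] [IsManifold (𝓡 n) ∞ M] {D : AffineConnection n M}

theorem christoffel_flat (hD : D.ContMDiffCovariantDerivative ∞) (hflat : IsFlatConnection D)
    {η : OpenPartialHomeomorph M (EuclideanSpace ℝ (Fin n))}
    (hη : η ∈ IsManifold.maximalAtlas (𝓡 n) ∞ M) {x : M} (hx : x ∈ η.source)
    (u v w : EuclideanSpace ℝ (Fin n)) :
    fderiv ℝ (christoffel D η) (η x) u v w +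
        christoffel D η (η x) u (christoffel D η (η x) v w) =
      fderiv ℝ (christoffel D η) (η x) v u w +
        christoffel D η (η x) v (christoffel D η (η x) u w) := by
  have h : curvature D (chartField η u) (chartField η v) (chartField η w) x = 0 :=
    hflat x _ _ _ (contMDiffAt_chartField hη hx u) (contMDiffAt_chartField hη hx v)
      (contMDiffAt_chartField hη hx w)
  rw [curvature, mlieBracket_chartField hη hx, map_zero, sub_zero, sub_eq_zero,
    covariantDerivative_covariantDerivative_chartField hD hη hx,
    covariantDerivative_covariantDerivative_chartField hD hη hx] at h
  exact chartField_injective hη hx h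

theorem exists_isParallelChart (hD : D.ContMDiffCovariantDerivative ∞) (htor : D.torsion = 0)
    (hflat : IsFlatConnection D) (p : M) :
    ∃ η ∈ IsManifold.maximalAtlas (𝓡 n) ∞ M, p ∈ η.source ∧ IsParallelChart D η := by
  set φ := chartAt (EuclideanSpace ℝ (Fin n)) p
  have hφ : φ ∈ IsManifold.maximalAtlas (𝓡 n) ∞ M := IsManifold.chart_mem_maximalAtlas p
  have hp : p ∈ φ.source := mem_chart_source _ p
  have hlocal : ∀ᶠ y in 𝓝 (φ p), ∃ x ∈ φ.source, φ x = y :=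
    (φ.open_target.eventually_mem (φ.map_source hp)).mono fun y hy ↦
      ⟨φ.symm y, φ.map_target hy, φ.right_inv hy⟩
  obtain ⟨τ, hpτ, hτ, hτ_symm, hpar⟩ := exists_affine_openPartialHomeomorph
    (C := christoffel D φ) (x₀ := φ p)
    (hlocal.mono fun y ⟨x, hx, hxy⟩ ↦ hxy ▸ contDiffAt_christoffel hD hφ hx)
    (hlocal.mono fun y ⟨x, hx, hxy⟩ ↦ hxy ▸ christoffel_symm htor hφ hx)
    (hlocal.mono fun y ⟨x, hx, hxy⟩ ↦ hxy ▸ christoffel_flat hD hflat hφ hx)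
  exact ⟨φ.trans τ, trans_mem_maximalAtlas hφ hτ hτ_symm, ⟨hp, hpτ⟩,
    isParallelChart_trans hφ hτ hpar⟩

end FlatConnection

section Legendre

theorem exists_hessian_potential {E : Type*} [NormedAddCommGroup E] [NormedSpace ℝ E]
    {G : E → E →L[ℝ] StrongDual ℝ E} {V : Set E} (hV : IsOpen V) (hconv : Convex ℝ V)
    (hG : ContDiffOn ℝ ∞ G V) (hsymm : ∀ y ∈ V, ∀ u v, G y u v = G y v u)
    (hcodazzi : ∀ y ∈ V, ∀ u v w, fderiv ℝ G y u v w = fderiv ℝ G y v u w) :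
    ∃ (l : E → StrongDual ℝ E) (ψ : E → ℝ), ContDiffOn ℝ ∞ l V ∧
      ∀ y ∈ V, HasFDerivAt l (G y) y ∧ HasFDerivAt ψ (l y) y := by
  obtain ⟨l, hl⟩ := hconv.exists_forall_hasFDerivAt_of_fderiv_symmetric hV
    (hG.differentiableOn (by simp)) fun y hy u v ↦ by ext w; exact hcodazzi y hy u v w
  obtain ⟨ψ, hψ⟩ := hconv.exists_forall_hasFDerivAt_of_fderiv_symmetric hV
    (fun y hy ↦ (hl y hy).differentiableAt.differentiableWithinAt)
    fun y hy u v ↦ by rw [(hl y hy).fderiv]; exact hsymm y hy u v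
  exact ⟨l, ψ, contDiffOn_infty_of_hasFDerivAt hV hl hG, fun y hy ↦ ⟨hl y hy, hψ y hy⟩⟩

variable {E : Type*} [NormedAddCommGroup E] [InnerProductSpace ℝ E]

/-- The Legendre transform `ψ*(ξ) = ⟨ξ, y⟩ - ψ(y)`, with `y = τ⁻¹ ξ`, of a function `ψ` whose
gradient is `τ`. -/
def legendreTransform (τ : OpenPartialHomeomorph E E) (ψ : E → ℝ) (ξ : E) : ℝ :=
  inner ℝ ξ (τ.symm ξ) - ψ (τ.symm ξ)

theorem add_legendreTransform {τ : OpenPartialHomeomorph E E} {y : E} (hy : y ∈ τ.source)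
    (ψ : E → ℝ) : ψ y + legendreTransform τ ψ (τ y) = inner ℝ (τ y) y := by
  rw [legendreTransform, τ.left_inv hy, add_sub_cancel]

variable [CompleteSpace E]

variable (E) in
/-- The Riesz isomorphism of a real Hilbert space with its dual, which Mathlib only provides as a
conjugate-linear equivalence. -/
def rieszEquiv : E ≃L[ℝ] StrongDual ℝ E :=
  (InnerProductSpace.toDual ℝ E).toContinuousLinearEquiv

theorem inner_rieszEquiv_symm (l : StrongDual ℝ E) (v : E) :
    inner ℝ ((rieszEquiv E).symm l) v = l v :=
  InnerProductSpace.toDual_symm_apply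

/-- The diffeomorphism `τ` is the gradient of the function `ψ`. -/
structure IsLegendreMap (τ : OpenPartialHomeomorph E E) (ψ : E → ℝ) : Prop where
  contDiffOn : ContDiffOn ℝ ∞ τ τ.source
  contDiffOn_symm : ContDiffOn ℝ ∞ τ.symm τ.target
  hasGradientAt : ∀ y ∈ τ.source, HasGradientAt ψ (τ y) y

theorem exists_isLegendreMap {G : E → E →L[ℝ] StrongDual ℝ E} {U : Set E} (hU : IsOpen U) {y₀ : E}
    (hy₀ : y₀ ∈ U) (hG : ContDiffOn ℝ ∞ G U) (hsymm : ∀ y ∈ U, ∀ u v, G y u v = G y v u)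
    (hinv : ∀ y ∈ U, (G y).IsInvertible)
    (hcodazzi : ∀ y ∈ U, ∀ u v w, fderiv ℝ G y u v w = fderiv ℝ G y v u w) :
    ∃ (τ : OpenPartialHomeomorph E E) (ψ : E → ℝ), y₀ ∈ τ.source ∧ τ.source ⊆ U ∧
      IsLegendreMap τ ψ ∧ ∀ y ∈ τ.source, ∀ u v, G y u v = inner ℝ (fderiv ℝ τ y u) v := by
  obtain ⟨r, hr, hrU⟩ := Metric.isOpen_iff.1 hU y₀ hy₀
  obtain ⟨l, ψ, hl, hlψ⟩ := exists_hessian_potential isOpen_ball (convex_ball y₀ r)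
    (hG.mono hrU) (fun y hy ↦ hsymm y (hrU hy)) fun y hy ↦ hcodazzi y (hrU hy)
  have hgrad : ∀ y ∈ ball y₀ r, HasFDerivAt (fun z ↦ (rieszEquiv E).symm (l z))
      ((rieszEquiv E).symm.toContinuousLinearMap ∘L G y) y :=
    fun y hy ↦ (rieszEquiv E).symm.hasFDerivAt.comp y (hlψ y hy).1
  have hgrad_smooth : ContDiffOn ℝ ∞ (fun z ↦ (rieszEquiv E).symm (l z)) (ball y₀ r) :=
    (rieszEquiv E).symm.contDiff.comp_contDiffOn hl
  obtain ⟨τ, hy₀τ, hτ, hτl, hτ_symm⟩ := exists_openPartialHomeomorph_of_contDiffOn isOpen_ball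
    hgrad_smooth (fun y hy ↦ (hgrad y hy).fderiv ▸
      ContinuousLinearMap.isInvertible_equiv.comp (hinv y (hrU hy))) (mem_ball_self hr)
  refine ⟨τ, ψ, hy₀τ, hτ.trans hrU, ⟨hτl ▸ hgrad_smooth.mono hτ, hτ_symm, fun y hy ↦ ?_⟩,
    fun y hy u v ↦ ?_⟩
  · rw [hasGradientAt_iff_hasFDerivAt, hτl]
    exact (hlψ y (hτ hy)).2.congr_fderiv ((rieszEquiv E).apply_symm_apply (l y)).symm
  · rw [hτl, (hgrad y (hτ hy)).fderiv]
    exact (inner_rieszEquiv_symm _ _).symm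

namespace IsLegendreMap

variable {τ : OpenPartialHomeomorph E E} {ψ : E → ℝ} (h : IsLegendreMap τ ψ) {y : E}
include h

theorem differentiableAt (hy : y ∈ τ.source) : DifferentiableAt ℝ τ y :=
  (h.contDiffOn.contDiffAt (τ.open_source.mem_nhds hy)).differentiableAt (by simp)

theorem differentiableAt_symm {ξ : E} (hξ : ξ ∈ τ.target) : DifferentiableAt ℝ τ.symm ξ :=
  (h.contDiffOn_symm.contDiffAt (τ.open_target.mem_nhds hξ)).differentiableAt (by simp)

theorem contDiffOn_potential : ContDiffOn ℝ ∞ ψ τ.source :=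
  contDiffOn_infty_of_hasFDerivAt τ.open_source (fun y hy ↦ (h.hasGradientAt y hy).hasFDerivAt)
    ((rieszEquiv E).contDiff.comp_contDiffOn h.contDiffOn)

/-- The terms containing the derivative of `τ⁻¹` cancel, because `ξ` is the gradient of `ψ` at
`τ⁻¹ ξ`. -/
theorem hasGradientAt_legendreTransform {ξ : E} (hξ : ξ ∈ τ.target) :
    HasGradientAt (legendreTransform τ ψ) (τ.symm ξ) ξ := by
  have hψ := (h.hasGradientAt _ (τ.map_target hξ)).hasFDerivAt
  have hsymm := (h.differentiableAt_symm hξ).hasFDerivAt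
  rw [hasGradientAt_iff_hasFDerivAt]
  refine (((hasFDerivAt_id ξ).inner ℝ hsymm).sub (hψ.comp ξ hsymm)).congr_fderiv ?_
  ext v
  simp [τ.right_inv hξ, real_inner_comm]

theorem symm : IsLegendreMap τ.symm (legendreTransform τ ψ) :=
  ⟨h.contDiffOn_symm, h.contDiffOn, fun _ ↦ h.hasGradientAt_legendreTransform⟩

theorem fderiv_symm_comp_fderiv (hy : y ∈ τ.source) :
    fderiv ℝ τ.symm (τ y) ∘L fderiv ℝ τ y = ContinuousLinearMap.id ℝ E := by
  have hcomp := (h.differentiableAt_symm (τ.map_source hy)).hasFDerivAt.comp y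
    (h.differentiableAt hy).hasFDerivAt
  refine hcomp.unique ((hasFDerivAt_id y).congr_of_eventuallyEq ?_)
  exact (τ.open_source.eventually_mem hy).mono fun z hz ↦ τ.left_inv hz

theorem fderiv_comp_fderiv_symm (hy : y ∈ τ.source) :
    fderiv ℝ τ y ∘L fderiv ℝ τ.symm (τ y) = ContinuousLinearMap.id ℝ E := by
  simpa [τ.left_inv hy] using h.symm.fderiv_symm_comp_fderiv (τ.map_source hy)

theorem inverse_fderiv (hy : y ∈ τ.source) :
    (fderiv ℝ τ y).inverse = fderiv ℝ τ.symm (τ y) :=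
  ContinuousLinearMap.inverse_eq (h.fderiv_comp_fderiv_symm hy) (h.fderiv_symm_comp_fderiv hy)

end IsLegendreMap

end Legendre

section MongeAmpereEquation

variable {n : ℕ} {ψ : EuclideanSpace ℝ (Fin n) → ℝ}

theorem contDiffOn_partialDeriv {V : Set (EuclideanSpace ℝ (Fin n))} (hV : IsOpen V)
    (hψ : ContDiffOn ℝ ∞ ψ V) (i : Fin n) : ContDiffOn ℝ ∞ (partialDeriv i ψ) V :=
  ((contDiffOn_infty_iff_fderiv_of_isOpen hV).1 hψ).2.clm_apply contDiffOn_const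

theorem solvesMongeAmpere_det_hessian {V : Set (EuclideanSpace ℝ (Fin n))} (hV : IsOpen V)
    (hψ : ContDiffOn ℝ ∞ ψ V) (hpos : ∀ y ∈ V, (hessian ψ y).PosDef) :
    SolvesMongeAmpere V ψ fun y ↦ (hessian ψ y).det where
  isOpen_domain := hV
  smooth := hψ
  smooth_rhs := by
    simp only [Matrix.det_apply]
    refine ContDiffOn.sum fun σ _ ↦ ContDiffOn.const_smul _ (contDiffOn_prod fun i _ ↦ ?_)
    exact contDiffOn_partialDeriv hV (contDiffOn_partialDeriv hV hψ i) (σ i)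
  rhs_pos y hy := (hpos y hy).det_pos
  elliptic := hpos
  det_hessian _ _ := rfl

namespace IsLegendreMap

variable {τ : OpenPartialHomeomorph (EuclideanSpace ℝ (Fin n)) (EuclideanSpace ℝ (Fin n))}
  {y : EuclideanSpace ℝ (Fin n)} (h : IsLegendreMap τ ψ)
include h

theorem partialDeriv_eq (hy : y ∈ τ.source) (i : Fin n) : partialDeriv i ψ y = τ y i := by
  rw [partialDeriv, (h.hasGradientAt y hy).hasFDerivAt.fderiv,
    InnerProductSpace.toDual_apply_apply, EuclideanSpace.inner_single_right, one_mul]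
  rfl

theorem partialDeriv_legendreTransform (hy : y ∈ τ.source) (i : Fin n) :
    partialDeriv i (legendreTransform τ ψ) (τ y) = y i := by
  rw [h.symm.partialDeriv_eq (τ.map_source hy), τ.left_inv hy]

theorem hessian_apply (hy : y ∈ τ.source) (i j : Fin n) :
    hessian ψ y i j = fderiv ℝ τ y (EuclideanSpace.single i 1) j := by
  have hj : HasFDerivAt (partialDeriv j ψ) (EuclideanSpace.proj j ∘L fderiv ℝ τ y) y :=
    ((EuclideanSpace.proj j).hasFDerivAt.comp y
      (h.differentiableAt hy).hasFDerivAt).congr_of_eventuallyEq <|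
        (τ.open_source.eventually_mem hy).mono fun z hz ↦ h.partialDeriv_eq hz j
  rw [hessian, Matrix.of_apply, partialDeriv, hj.fderiv]
  rfl

theorem hessian_mul_hessian (hy : y ∈ τ.source) :
    hessian (legendreTransform τ ψ) (τ y) * hessian ψ y = 1 := by
  ext i j
  set v := fderiv ℝ τ.symm (τ y) (EuclideanSpace.single i 1)
  have hv : v = ∑ k, v k • EuclideanSpace.single k (1 : ℝ) := by
    simpa using ((EuclideanSpace.basisFun (Fin n) ℝ).sum_repr v).symm
  calc (hessian (legendreTransform τ ψ) (τ y) * hessian ψ y) i j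
    _ = ∑ k, v k * fderiv ℝ τ y (EuclideanSpace.single k 1) j :=
      Matrix.mul_apply.trans <| Finset.sum_congr rfl fun k _ ↦ by
        rw [h.symm.hessian_apply (τ.map_source hy), h.hessian_apply hy]
    _ = fderiv ℝ τ y v j := by
      conv_rhs => rw [hv]
      simp
    _ = (1 : Matrix (Fin n) (Fin n) ℝ) i j := by
      have := congr($(h.fderiv_comp_fderiv_symm hy) (EuclideanSpace.single i 1))
      rw [ContinuousLinearMap.comp_apply] at this
      simp [v, this, Matrix.one_apply, eq_comm]

end IsLegendreMap

end MongeAmpereEquation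

section MetricForm

variable {n : ℕ} {M : Type*} [TopologicalSpace M] [ChartedSpace (EuclideanSpace ℝ (Fin n)) M]
  [IsManifold (𝓡 n) ∞ M] {g : SmoothMetric n M} {D D' : AffineConnection n M}
  {η : OpenPartialHomeomorph M (EuclideanSpace ℝ (Fin n))} {x : M}

/-- The representation of the metric `g` in the chart `η`, as a family of bilinear forms on the
model space. -/
def metricForm (g : SmoothMetric n M) (η : OpenPartialHomeomorph M (EuclideanSpace ℝ (Fin n)))
    (y : EuclideanSpace ℝ (Fin n)) :
    EuclideanSpace ℝ (Fin n) →L[ℝ] StrongDual ℝ (EuclideanSpace ℝ (Fin n)) :=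
  letI A : EuclideanSpace ℝ (Fin n) →L[ℝ] EuclideanSpace ℝ (Fin n) :=
    (mfderiv (𝓡 n) (𝓡 n) η (η.symm y)).inverse
  letI B : EuclideanSpace ℝ (Fin n) →L[ℝ] StrongDual ℝ (EuclideanSpace ℝ (Fin n)) :=
    g.inner (η.symm y)
  B.bilinearComp A A

theorem metricForm_apply (hx : x ∈ η.source) (u v : EuclideanSpace ℝ (Fin n)) :
    metricForm g η (η x) u v = g.inner x (chartField η u x) (chartField η v x) := by
  have h : ∀ y, metricForm g η y u v =
    g.inner (η.symm y) (chartField η u (η.symm y)) (chartField η v (η.symm y)) := fun _ ↦ rfl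
  rw [h, η.left_inv hx]

theorem metricForm_symm (hx : x ∈ η.source) (u v : EuclideanSpace ℝ (Fin n)) :
    metricForm g η (η x) u v = metricForm g η (η x) v u := by
  rw [metricForm_apply hx, metricForm_apply hx, g.symm]

theorem contMDiffAt_metric_apply {X Y : Π x : M, TangentSpace (𝓡 n) x}
    (hX : SmoothFieldAt X x) (hY : SmoothFieldAt Y x) :
    ContMDiffAt (𝓡 n) 𝓘(ℝ, ℝ) ∞ (fun y ↦ g.inner y (X y) (Y y)) x := by
  have : ContMDiffAt (𝓡 n) ((𝓡 n).prod 𝓘(ℝ)) ∞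
      (fun y ↦ Bundle.TotalSpace.mk' ℝ (E := Bundle.Trivial M ℝ) y (g.inner y (X y) (Y y))) x :=
    ContMDiffAt.clm_bundle_apply₂ (F₁ := EuclideanSpace ℝ (Fin n))
      (F₂ := EuclideanSpace ℝ (Fin n)) g.contMDiff.contMDiffAt hX hY
  exact (Bundle.contMDiffAt_totalSpace.1 this).2

theorem mvfderiv_congr {E H M F : Type*} [NormedAddCommGroup E] [NormedSpace ℝ E]
    [TopologicalSpace H] {I : ModelWithCorners ℝ E H} [TopologicalSpace M] [ChartedSpace H M]
    [NormedAddCommGroup F] [NormedSpace ℝ F] {f f' : M → F} {x : M} (h : f =ᶠ[𝓝 x] f') :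
    mvfderiv I f x = mvfderiv I f' x := by
  ext z
  change mfderiv I 𝓘(ℝ, F) f x z = mfderiv I 𝓘(ℝ, F) f' x z
  rw [h.mfderiv_eq]
  rfl

variable (hη : η ∈ IsManifold.maximalAtlas (𝓡 n) ∞ M)
include hη

theorem metricForm_self_pos (hx : x ∈ η.source) {u : EuclideanSpace ℝ (Fin n)} (hu : u ≠ 0) :
    0 < metricForm g η (η x) u u := by
  rw [metricForm_apply hx]
  exact g.pos x _ fun h ↦ hu (chartField_injective hη hx (h.trans chartField_zero.symm))

theorem isInvertible_metricForm (hx : x ∈ η.source) : (metricForm g η (η x)).IsInvertible := by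
  have hinj : Function.Injective (metricForm g η (η x)) :=
    (injective_iff_map_eq_zero _).2 fun u hu ↦ by
      by_contra hne
      exact (metricForm_self_pos (g := g) hη hx hne).ne' (by rw [hu, zero_apply])
  exact ⟨(LinearEquiv.ofInjectiveOfFinrankEq (metricForm g η (η x)).toLinearMap hinj
    (rieszEquiv (EuclideanSpace ℝ (Fin n))).toLinearEquiv.finrank_eq).toContinuousLinearEquiv, rfl⟩

theorem contDiffOn_metricForm : ContDiffOn ℝ ∞ (metricForm g η) η.target := by
  refine contDiffOn_clm_apply.2 fun u ↦ contDiffOn_clm_apply.2 fun v y hy ↦ ?_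
  have hmetric := contMDiffAt_metric_apply (g := g)
    (contMDiffAt_chartField hη (η.map_target hy) u) (contMDiffAt_chartField hη (η.map_target hy) v)
  exact (hmetric.comp y
    (contMDiffAt_symm_of_mem_maximalAtlas hη hy)).contDiffAt.contDiffWithinAt

theorem differentiableAt_metricForm (hx : x ∈ η.source) :
    DifferentiableAt ℝ (metricForm g η) (η x) :=
  ((contDiffOn_metricForm hη).contDiffAt
    (η.open_target.mem_nhds (η.map_source hx))).differentiableAt (by simp)

theorem fderiv_metricForm_apply (hdual : AreDualConnections g D D') (hx : x ∈ η.source)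
    (u v w : EuclideanSpace ℝ (Fin n)) :
    fderiv ℝ (metricForm g η) (η x) u v w =
      g.inner x (D (chartField η v) x (chartField η u x)) (chartField η w x) +
        g.inner x (chartField η v x) (D' (chartField η w) x (chartField η u x)) := by
  have hG := hasFDerivAt_apply_apply (differentiableAt_metricForm (g := g) hη hx) v w
  have hchart : (fun y ↦ g.inner y (chartField η v y) (chartField η w y)) =ᶠ[𝓝 x]
      fun y ↦ metricForm g η (η y) v w :=
    (η.open_source.eventually_mem hx).mono fun y hy ↦ (metricForm_apply hy v w).symm
  rw [← hdual x _ _ _ (mdifferentiableAt_chartField hη hx v) (mdifferentiableAt_chartField hη hx w),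
    mvfderiv_congr hchart,
    mvfderiv_comp_chart (f := fun z ↦ metricForm g η z v w) hη hx hG.differentiableAt, hG.fderiv]
  rfl

theorem fderiv_metricForm_swap (hx : x ∈ η.source) (u v w : EuclideanSpace ℝ (Fin n)) :
    fderiv ℝ (metricForm g η) (η x) u v w = fderiv ℝ (metricForm g η) (η x) u w v := by
  have hG := differentiableAt_metricForm (g := g) hη hx
  have hsymm : (fun y ↦ metricForm g η y v w) =ᶠ[𝓝 (η x)] fun y ↦ metricForm g η y w v := by
    filter_upwards [η.open_target.mem_nhds (η.map_source hx)] with y hy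
    rw [← η.right_inv hy, metricForm_symm (η.map_target hy)]
  exact congr($(((hasFDerivAt_apply_apply hG w v).congr_of_eventuallyEq hsymm).unique
    (hasFDerivAt_apply_apply hG v w)) u).symm

/-- In a `D`-affine chart the derivative of the metric is `g(v, ∇*_u w)`, which is symmetric in `u`
and `w` because `∇*` is torsion-free. -/
theorem fderiv_metricForm_comm (hdual : AreDualConnections g D D') (htor : D'.torsion = 0)
    (hpar : IsParallelChart D η) (hx : x ∈ η.source) (u v w : EuclideanSpace ℝ (Fin n)) :
    fderiv ℝ (metricForm g η) (η x) u v w = fderiv ℝ (metricForm g η) (η x) w v u := by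
  rw [fderiv_metricForm_apply hη hdual hx, fderiv_metricForm_apply hη hdual hx, hpar x hx,
    covariantDerivative_chartField hη hx, covariantDerivative_chartField hη hx,
    christoffel_symm htor hη hx u w]
  simp

theorem fderiv_metricForm_codazzi (hdual : AreDualConnections g D D') (htor : D'.torsion = 0)
    (hpar : IsParallelChart D η) (hx : x ∈ η.source) (u v w : EuclideanSpace ℝ (Fin n)) :
    fderiv ℝ (metricForm g η) (η x) u v w = fderiv ℝ (metricForm g η) (η x) v u w := by
  rw [fderiv_metricForm_comm hη hdual htor hpar hx, fderiv_metricForm_swap hη hx,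
    fderiv_metricForm_comm hη hdual htor hpar hx]

end MetricForm

section HessianChart

variable {n : ℕ} {M : Type*} [TopologicalSpace M] [ChartedSpace (EuclideanSpace ℝ (Fin n)) M]
  [IsManifold (𝓡 n) ∞ M] {g : SmoothMetric n M} {D D' : AffineConnection n M}
  {η : OpenPartialHomeomorph M (EuclideanSpace ℝ (Fin n))} {x : M}

theorem isAffineCoord_of_isParallelChart (h : IsParallelChart D η) : IsAffineCoord D η :=
  fun x hx i j ↦ congr($(h x hx (EuclideanSpace.single j 1)) (coordField η i x))

omit [IsManifold (𝓡 n) ∞ M] in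
theorem chartField_eq_sum_coordField (u : EuclideanSpace ℝ (Fin n)) :
    chartField η u x = ∑ i, u i • coordField η i x := by
  conv_lhs => rw [← (EuclideanSpace.basisFun (Fin n) ℝ).sum_repr u]
  simp only [chartField_sum, chartField_smul, EuclideanSpace.basisFun_repr,
    EuclideanSpace.basisFun_apply]
  rfl

theorem posDef_metricMatrix (hη : η ∈ IsManifold.maximalAtlas (𝓡 n) ∞ M) (hx : x ∈ η.source) :
    (metricMatrix g η x).PosDef := by
  refine Matrix.PosDef.of_dotProduct_mulVec_pos (Matrix.ext fun i j ↦ g.symm x _ _) fun v hv ↦ ?_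
  have hpos := metricForm_self_pos (g := g) hη hx ((WithLp.toLp_eq_zero 2).not.2 hv)
  rw [metricForm_apply hx, chartField_eq_sum_coordField] at hpos
  refine hpos.trans_eq ?_
  simp only [map_sum, map_smul, sum_apply, smul_apply, smul_eq_mul, dotProduct, Matrix.mulVec,
    metricMatrix, Matrix.of_apply, Finset.mul_sum, star_trivial]
  refine Finset.sum_comm.trans <| Finset.sum_congr rfl fun i _ ↦ Finset.sum_congr rfl fun j _ ↦ ?_
  ring

/-- Differentiating the pairing shows that the derivatives of `chartField η' v` are orthogonal to
all fields `chartField η u`. -/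
theorem isParallelChart_of_pairing_const
    {η' : OpenPartialHomeomorph M (EuclideanSpace ℝ (Fin n))}
    {c : EuclideanSpace ℝ (Fin n) → EuclideanSpace ℝ (Fin n) → ℝ}
    (hdual : AreDualConnections g D D') (hη : η ∈ IsManifold.maximalAtlas (𝓡 n) ∞ M)
    (hη' : η' ∈ IsManifold.maximalAtlas (𝓡 n) ∞ M) (hsource : η'.source ⊆ η.source)
    (hpar : IsParallelChart D η)
    (hpair : ∀ x ∈ η'.source, ∀ u v, g.inner x (chartField η u x) (chartField η' v x) = c u v) :
    IsParallelChart D' η' := by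
  intro x hx v
  ext z
  have horth : ∀ u, g.inner x (chartField η u x) (D' (chartField η' v) x z) = 0 := fun u ↦ by
    have hconst : (fun y ↦ g.inner y (chartField η u y) (chartField η' v y)) =ᶠ[𝓝 x]
        fun _ ↦ c u v := (η'.open_source.eventually_mem hx).mono fun y hy ↦ hpair y hy u v
    have hderiv := hdual x z _ _ (mdifferentiableAt_chartField hη (hsource hx) u)
      (mdifferentiableAt_chartField hη' hx v)
    rw [mvfderiv_congr hconst, mvfderiv_const, hpar x (hsource hx) u] at hderiv
    simpa using hderiv.symm
  obtain ⟨u, hu⟩ := exists_chartField_eq hη (hsource hx) (D' (chartField η' v) x z)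
  by_contra hne
  exact (g.pos x _ hne).ne' (hu ▸ horth u)

/-- The metric is in the chart `η` the Hessian of the potential `ψ`, whose gradient `τ` is the
transition map from `η` to the dual chart `η.trans τ`. -/
structure IsHessianChart (g : SmoothMetric n M)
    (η : OpenPartialHomeomorph M (EuclideanSpace ℝ (Fin n)))
    (τ : OpenPartialHomeomorph (EuclideanSpace ℝ (Fin n)) (EuclideanSpace ℝ (Fin n)))
    (ψ : EuclideanSpace ℝ (Fin n) → ℝ) : Prop where
  mem_maximalAtlas : η ∈ IsManifold.maximalAtlas (𝓡 n) ∞ M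
  target_subset : η.target ⊆ τ.source
  isLegendreMap : IsLegendreMap τ ψ
  inner_chartField : ∀ x ∈ η.source, ∀ u v,
    g.inner x (chartField η u x) (chartField η v x) = inner ℝ (fderiv ℝ τ (η x) u) v

theorem exists_isHessianChart [T2Space M] (hD : D.ContMDiffCovariantDerivative ∞)
    (hdual : AreDualConnections g D D') (htor : D.torsion = 0) (htor' : D'.torsion = 0)
    (hflat : IsFlatConnection D) (p : M) :
    ∃ η τ ψ, p ∈ η.source ∧ IsParallelChart D η ∧ IsHessianChart g η τ ψ := by
  obtain ⟨φ, hφ, hp, hpar⟩ := exists_isParallelChart hD htor hflat p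
  have hlift : ∀ y ∈ φ.target, ∃ x ∈ φ.source, φ x = y := fun y hy ↦
    ⟨φ.symm y, φ.map_target hy, φ.right_inv hy⟩
  obtain ⟨τ, ψ, hpτ, -, hτ, hmetric⟩ := exists_isLegendreMap φ.open_target (φ.map_source hp)
    (contDiffOn_metricForm (g := g) hφ)
    (fun y hy ↦ by obtain ⟨x, hx, rfl⟩ := hlift y hy; exact metricForm_symm hx)
    (fun y hy ↦ by obtain ⟨x, hx, rfl⟩ := hlift y hy; exact isInvertible_metricForm hφ hx)
    (fun y hy ↦ by
      obtain ⟨x, hx, rfl⟩ := hlift y hy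
      exact fderiv_metricForm_codazzi hφ hdual htor' hpar hx)
  refine ⟨φ.trans (.ofSet τ.source τ.open_source), τ, ψ, ⟨hp, hpτ⟩, fun x hx ↦ hpar x hx.1,
    trans_mem_maximalAtlas hφ contDiffOn_id contDiffOn_id, fun y hy ↦ hy.1, hτ, fun x hx u v ↦ ?_⟩
  exact (metricForm_apply hx.1 u v).symm.trans (hmetric (φ x) hx.2 u v)

namespace IsHessianChart

variable {τ : OpenPartialHomeomorph (EuclideanSpace ℝ (Fin n)) (EuclideanSpace ℝ (Fin n))}
  {ψ : EuclideanSpace ℝ (Fin n) → ℝ} (h : IsHessianChart g η τ ψ)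
include h

theorem source_trans : (η.trans τ).source = η.source := by
  rw [OpenPartialHomeomorph.trans_source, inter_eq_left]
  exact fun x hx ↦ h.target_subset (η.map_source hx)

theorem trans_mem_maximalAtlas : η.trans τ ∈ IsManifold.maximalAtlas (𝓡 n) ∞ M :=
  _root_.trans_mem_maximalAtlas h.mem_maximalAtlas h.isLegendreMap.contDiffOn
    h.isLegendreMap.contDiffOn_symm

theorem hessian_eq_metricMatrix (hx : x ∈ η.source) : hessian ψ (η x) = metricMatrix g η x := by
  ext i j
  rw [h.isLegendreMap.hessian_apply (h.target_subset (η.map_source hx))]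
  refine Eq.trans ?_ (h.inner_chartField x hx _ _).symm
  simp [EuclideanSpace.inner_single_right]

theorem solvesMongeAmpere : SolvesMongeAmpere η.target ψ fun y ↦ (hessian ψ y).det := by
  refine solvesMongeAmpere_det_hessian η.open_target
    (h.isLegendreMap.contDiffOn_potential.mono h.target_subset) fun y hy ↦ ?_
  rw [← η.right_inv hy, h.hessian_eq_metricMatrix (η.map_target hy)]
  exact posDef_metricMatrix h.mem_maximalAtlas (η.map_target hy)

theorem chartField_trans_eq (hx : x ∈ η.source) (v : EuclideanSpace ℝ (Fin n)) :
    chartField (η.trans τ) v x = chartField η (fderiv ℝ τ.symm (τ (η x)) v) x := by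
  have hxτ := h.target_subset (η.map_source hx)
  rw [chartField_trans h.mem_maximalAtlas hx (h.isLegendreMap.differentiableAt hxτ),
    h.isLegendreMap.inverse_fderiv hxτ]

theorem inner_chartField_trans (hx : x ∈ η.source) (u v : EuclideanSpace ℝ (Fin n)) :
    g.inner x (chartField η u x) (chartField (η.trans τ) v x) = inner ℝ u v := by
  have hcomp := congr($(h.isLegendreMap.fderiv_comp_fderiv_symm
    (h.target_subset (η.map_source hx))) v)
  rw [h.chartField_trans_eq hx, g.symm, h.inner_chartField x hx, real_inner_comm]
  exact congrArg (inner ℝ u) hcomp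

theorem dual : IsHessianChart g (η.trans τ) τ.symm (legendreTransform τ ψ) where
  mem_maximalAtlas := h.trans_mem_maximalAtlas
  target_subset := inter_subset_left
  isLegendreMap := h.isLegendreMap.symm
  inner_chartField x hx u v := by
    have hx' : x ∈ η.source := hx.1
    rw [h.chartField_trans_eq hx', h.inner_chartField_trans hx', OpenPartialHomeomorph.coe_trans,
      Function.comp_apply]

theorem isParallelChart_trans (hdual : AreDualConnections g D D') (hpar : IsParallelChart D η) :
    IsParallelChart D' (η.trans τ) :=
  isParallelChart_of_pairing_const hdual h.mem_maximalAtlas h.trans_mem_maximalAtlas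
    inter_subset_left hpar fun _ hx ↦ h.inner_chartField_trans hx.1

theorem areDualCoord : AreDualCoord g η (η.trans τ) := by
  refine ⟨h.source_trans.symm, fun x hx i j ↦ (h.inner_chartField_trans hx _ _).trans ?_⟩
  simp [EuclideanSpace.inner_single_left]

theorem hessian_legendreTransform_eq_inv (hx : x ∈ η.source) :
    hessian (legendreTransform τ ψ) (τ (η x)) = (metricMatrix g η x)⁻¹ := by
  rw [← h.hessian_eq_metricMatrix hx]
  exact (Matrix.inv_eq_left_inv <|
    h.isLegendreMap.hessian_mul_hessian (h.target_subset (η.map_source hx))).symm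

end IsHessianChart

/-- The Monge–Ampère structure formed by Hessian charts around the points of a manifold; the
right-hand side of the equation is the Hessian determinant itself. -/
def mongeAmpereStructureOfHessianCharts
    {η : M → OpenPartialHomeomorph M (EuclideanSpace ℝ (Fin n))}
    {τ : M → OpenPartialHomeomorph (EuclideanSpace ℝ (Fin n)) (EuclideanSpace ℝ (Fin n))}
    {ψ : M → EuclideanSpace ℝ (Fin n) → ℝ} (h : ∀ p, IsHessianChart g (η p) (τ p) (ψ p))
    (hp : ∀ p, p ∈ (η p).source) : MongeAmpereStructure n M where
  coord := η
  potential := ψ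
  rhs p y := (hessian (ψ p) y).det
  mem_source := hp
  coord_mem_atlas p := (h p).mem_maximalAtlas
  solves p := (h p).solvesMongeAmpere

end HessianChart

end

theorem theoremT (n : ℕ) (M : Type*) [TopologicalSpace M] [T2Space M]
    [ChartedSpace (EuclideanSpace ℝ (Fin n)) M] [IsManifold (𝓡 n) ∞ M]
    (g : SmoothMetric n M) (D D' : AffineConnection n M) (h : IsDuallyFlat g D D') :
    -- `S` is the structure in the `η` coordinates, `S'` the one in the dual coordinates `η*`
    ∃ S S' : MongeAmpereStructure n M, ∀ p : M,
      IsAffineCoord D (S.coord p) ∧ IsAffineCoord D' (S'.coord p) ∧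
      AreDualCoord g (S.coord p) (S'.coord p) ∧
      ∀ x ∈ (S.coord p).source,
        -- `g_{ij} = ∂ᵢ ∂ⱼ ψ` and `g^{ij} = ∂ⁱ ∂ʲ ψ*`
        hessian (S.potential p) (S.coord p x) = metricMatrix g (S.coord p) x ∧
        hessian (S'.potential p) (S'.coord p x) = metricMatrix g (S'.coord p) x ∧
        hessian (S'.potential p) (S'.coord p x) = (metricMatrix g (S.coord p) x)⁻¹ ∧
        -- Legendre transformation between the two coordinate systems
        (∀ i, S'.coord p x i = partialDeriv i (S.potential p) (S.coord p x)) ∧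
        (∀ i, S.coord p x i = partialDeriv i (S'.potential p) (S'.coord p x)) ∧
        S.potential p (S.coord p x) + S'.potential p (S'.coord p x)
          = ∑ i, S.coord p x i * S'.coord p x i := by
  choose η τ ψ hp hpar hη using
    exists_isHessianChart h.smooth h.dual h.torsion_free h.torsion_free' h.flat
  have hp' : ∀ p, p ∈ ((η p).trans (τ p)).source := fun p ↦ (hη p).source_trans.symm ▸ hp p
  refine ⟨mongeAmpereStructureOfHessianCharts hη hp,
    mongeAmpereStructureOfHessianCharts (fun p ↦ (hη p).dual) hp', fun p ↦
    ⟨isAffineCoord_of_isParallelChart (hpar p),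
      isAffineCoord_of_isParallelChart ((hη p).isParallelChart_trans h.dual (hpar p)),
      (hη p).areDualCoord, fun x (hx : x ∈ (η p).source) ↦ ?_⟩⟩
  have hxτ : η p x ∈ (τ p).source := (hη p).target_subset ((η p).map_source hx)
  have hx' : x ∈ ((η p).trans (τ p)).source := ⟨hx, hxτ⟩
  have hleg := (hη p).isLegendreMap
  refine ⟨(hη p).hessian_eq_metricMatrix hx, (hη p).dual.hessian_eq_metricMatrix hx',
    (hη p).hessian_legendreTransform_eq_inv hx, fun i ↦ (hleg.partialDeriv_eq hxτ i).symm,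
    fun i ↦ (hleg.partialDeriv_legendreTransform hxτ i).symm,
    (add_legendreTransform hxτ (ψ p)).trans (PiLp.inner_apply _ _)⟩
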